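/- Let $k$ be a field, let $N$ be a finite group and let $t$ be a positive integer. Assume that the center of $N$ is trivial and that $N$ is indecomposable, i.e. that $N$ is not isomorphic to a product of two nontrivial groups. For a ring $R$, write $N_R$ for the constant group scheme over $\operatorname{Spec}(R)$ attached to $N$. For group schemes $H$ and $G$ over a scheme $S$, say that $H$ is an $S$-form of $G$ if there is an étale cover $T\to S$ (a surjective étale morphism) such that the base changes $H_T$ and $G_T$ are isomorphic as group schemes over $T$; for $S=\operatorname{Spec}(R)$ one says $R$-form. Let $G$ be a group scheme over $k$ that is a $k$-form of the constant group scheme $(N^t)_k=(N_k)^t$. Then there exist an étale $k$-algebra $A$ of degree $t$ (that is, $\dim_k A=t$) and a group scheme $\widetilde{N_A}$ over $\operatorname{Spec}(A)$ which is an $A$-form of $N_A=N_k\times_{\operatorname{Spec}(k)}\operatorname{Spec}(A)$, such that $$G\simeq \operatorname{Res}_{A/k}(\widetilde{N_A})$$ as group schemes over $k$. Here $\operatorname{Res}_{A/k}(\widetilde{N_A})$ is the Weil restriction, i.e. the group scheme over $k$ representing the group functor $T\mapsto \widetilde{N_A}\bigl(T\times_{\operatorname{Spec}(k)}\operatorname{Spec}(A)\bigr)$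 on $k$-schemes; its existence is part of the claim. -/

import Mathlib

open CategoryTheory AlgebraicGeometry
open scoped TensorProduct

universe u

/-- A group is indecomposable if it is not isomorphic to a product of two nontrivial groups. -/
def IsIndecomposableGroup (N : Type u) [Group N] : Prop :=
  ∀ (H K : Type u) [Group H] [Group K], Nonempty (N ≃* H × K) → Subsingleton H ∨ Subsingleton K

/-- The `R`-algebra `R ^ N` of all functions on `N` with values in `R`, with the pointwise
operations. This is a separate type since `N → R` already carries an unrelated coalgebra
structure in Mathlib. -/
def FunctionAlgebra (R N : Type u) : Type u := N → R

namespace FunctionAlgebra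

variable (R N : Type u) [CommRing R]

noncomputable instance : CommRing (FunctionAlgebra R N) := inferInstanceAs (CommRing (N → R))

noncomputable instance : Algebra R (FunctionAlgebra R N) := inferInstanceAs (Algebra R (N → R))

/-- For finite `N`, the canonical isomorphism `B ⊗ R ^ N ≃ B ^ N`,
`b ⊗ f ↦ (n ↦ f n • b)`. -/
noncomputable def tensorEquiv [Finite N] (B : Type u) [CommRing B] [Algebra R B] :
    B ⊗[R] FunctionAlgebra R N ≃ₐ[R] (N → B) :=
  letI := Fintype.ofFinite N
  letI := Classical.decEq N
  Algebra.TensorProduct.piScalarRight R R B N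

variable {R N} in
theorem tensorEquiv_tmul [Finite N] (B : Type u) [CommRing B] [Algebra R B] (b : B)
    (f : FunctionAlgebra R N) (n : N) : tensorEquiv R N B (b ⊗ₜ f) n = f n • b := rfl

/-- Evaluation at `n`. -/
noncomputable def evalHom (n : N) : FunctionAlgebra R N →ₐ[R] R where
  toFun f := f n
  map_one' := rfl
  map_mul' _ _ := rfl
  map_zero' := rfl
  map_add' _ _ := rfl
  commutes' _ := rfl

variable {R N}

open Classical in
/-- The indicator function of `n`. -/
noncomputable def indicator (R : Type u) {N : Type u} [CommRing R] (n : N) :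
    FunctionAlgebra R N := fun m => if m = n then 1 else 0

theorem indicator_self (n : N) : indicator R n n = 1 := if_pos rfl

theorem indicator_of_ne {m n : N} (h : m ≠ n) : indicator R n m = 0 := if_neg h

theorem sum_apply {ι : Type u} (s : Finset ι) (f : ι → FunctionAlgebra R N) (x : N) :
    (∑ i ∈ s, f i) x = ∑ i ∈ s, f i x :=
  map_sum (evalHom R N x) f s

theorem mul_apply (f g : FunctionAlgebra R N) (x : N) : (f * g) x = f x * g x := rfl

theorem smul_apply (r : R) (f : FunctionAlgebra R N) (x : N) : (r • f) x = r * f x := rfl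

theorem sum_smul_indicator [Fintype N] (f : FunctionAlgebra R N) :
    ∑ n, f n • indicator R n = f := by
  funext x
  rw [sum_apply]
  rw [Finset.sum_eq_single x]
  · simp [smul_apply, indicator]
  · intro b _ hb
    simp [smul_apply, indicator, hb.symm]
  · simp

variable [Group N]

variable (R N) in
/-- The map `R ^ N → (N → R ^ N)`, `f ↦ (n ↦ (m ↦ f (m * n)))`. -/
noncomputable def translates : FunctionAlgebra R N →ₐ[R] (N → FunctionAlgebra R N) where
  toFun f n m := f (m * n)
  map_one' := rfl
  map_mul' _ _ := rfl
  map_zero' := rfl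
  map_add' _ _ := rfl
  commutes' _ := rfl

variable (R N) in
/-- The comultiplication of `R ^ N`: under `R ^ N ⊗ R ^ N ≃ R ^ (N × N)` it is
`f ↦ ((m, n) ↦ f (m * n))`. -/
noncomputable def comulHom [Finite N] :
    FunctionAlgebra R N →ₐ[R] FunctionAlgebra R N ⊗[R] FunctionAlgebra R N :=
  (tensorEquiv R N (FunctionAlgebra R N)).symm.toAlgHom.comp (translates R N)

variable (R N) in
/-- The map `f ↦ (n ↦ f n⁻¹)`. -/
noncomputable def invHom : FunctionAlgebra R N →ₐ[R] FunctionAlgebra R N where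
  toFun f n := f n⁻¹
  map_one' := rfl
  map_mul' _ _ := rfl
  map_zero' := rfl
  map_add' _ _ := rfl
  commutes' _ := rfl

theorem comulHom_apply [Fintype N] (f : FunctionAlgebra R N) :
    comulHom R N f = ∑ n, translates R N f n ⊗ₜ[R] indicator R n := by
  apply (tensorEquiv R N (FunctionAlgebra R N)).injective
  have h : tensorEquiv R N _ (comulHom R N f) = translates R N f := by simp [comulHom]
  rw [h, map_sum]
  funext n
  rw [Finset.sum_apply]
  rw [Finset.sum_eq_single n]
  · simp [tensorEquiv_tmul, indicator]
  · intro b _ hb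
    simp [tensorEquiv_tmul, indicator, hb.symm]
  · simp

theorem translates_indicator (n p : N) :
    translates R N (indicator R p) n = indicator R (p * n⁻¹) := by
  funext m
  change indicator R p (m * n) = _
  by_cases h : m * n = p
  · simp [indicator, eq_mul_inv_of_mul_eq h]
  · have h' : ¬ m = p * n⁻¹ := fun h' => h (by simp [h'])
    simp [indicator, h, h']

theorem translates_translates (f : FunctionAlgebra R N) (m n : N) :
    translates R N (translates R N f n) m = translates R N f (m * n) := by
  funext x
  change f (x * m * n) = f (x * (m * n))
  rw [mul_assoc]

/-- The Hopf algebra `R ^ N` of functions on the finite group `N`, with comultiplication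
`(Δ f) (m, n) = f (m * n)`, counit `f ↦ f 1` and antipode `(S f) n = f n⁻¹`. -/
noncomputable instance [Finite N] : HopfAlgebra R (FunctionAlgebra R N) :=
  letI : Bialgebra R (FunctionAlgebra R N) :=
    Bialgebra.ofAlgHom (comulHom R N) (evalHom R N 1)
      (by
        let _ := Fintype.ofFinite N
        refine AlgHom.ext fun f => ?_
        change Algebra.TensorProduct.assoc R R R _ _ _
          (Algebra.TensorProduct.map (comulHom R N) (.id R _) (comulHom R N f)) =
          Algebra.TensorProduct.map (.id R _) (comulHom R N) (comulHom R N f)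
        simp only [comulHom_apply f, map_sum, Algebra.TensorProduct.map_tmul,
          comulHom_apply, translates_translates, translates_indicator, TensorProduct.sum_tmul,
          TensorProduct.tmul_sum, AlgHom.id_apply, Algebra.TensorProduct.assoc_tmul]
        rw [Finset.sum_comm (s := Finset.univ (α := N))]
        conv_rhs => rw [Finset.sum_comm]
        conv_lhs => rw [Finset.sum_comm]
        refine Finset.sum_congr rfl fun n _ => ?_
        exact Fintype.sum_equiv (Equiv.mulRight n) _ _ fun m => by simp)
      (by
        let _ := Fintype.ofFinite N
        refine AlgHom.ext fun f => ?_
        change Algebra.TensorProduct.map (evalHom R N 1) (.id R _) (comulHom R N f) = 1 ⊗ₜ f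
        simp only [comulHom_apply f, map_sum, Algebra.TensorProduct.map_tmul, AlgHom.id_apply]
        conv_rhs => rw [← sum_smul_indicator f, TensorProduct.tmul_sum]
        refine Finset.sum_congr rfl fun n _ => ?_
        have h : evalHom R N 1 (translates R N f n) = f n := congrArg f (one_mul n)
        rw [h, TensorProduct.tmul_smul, TensorProduct.smul_tmul', smul_eq_mul, mul_one])
      (by
        let _ := Fintype.ofFinite N
        refine AlgHom.ext fun f => ?_
        change Algebra.TensorProduct.map (.id R _) (evalHom R N 1) (comulHom R N f) = f ⊗ₜ 1
        simp only [comulHom_apply f, map_sum, Algebra.TensorProduct.map_tmul, AlgHom.id_apply]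
        rw [Finset.sum_eq_single (1 : N)]
        · have h1 : translates R N f 1 = f := funext fun m => congrArg f (mul_one m)
          rw [h1, show evalHom R N 1 (indicator R 1) = 1 from indicator_self 1]
        · intro n _ hn
          rw [show evalHom R N 1 (indicator R n) = 0 from indicator_of_ne (Ne.symm hn),
            TensorProduct.tmul_zero]
        · simp)
  HopfAlgebra.ofAlgHom (invHom R N)
    (by
      let _ := Fintype.ofFinite N
      refine AlgHom.ext fun f => ?_
      change Algebra.TensorProduct.lift (invHom R N) (.id R _) (fun _ _ => Commute.all _ _)
        (comulHom R N f) = algebraMap R _ (f 1)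
      simp only [comulHom_apply f, map_sum, Algebra.TensorProduct.lift_tmul, AlgHom.id_apply]
      funext x
      rw [sum_apply, Finset.sum_eq_single x]
      · have h1 : invHom R N (translates R N f x) x = f 1 := congrArg f (inv_mul_cancel x)
        have h2 : algebraMap R (FunctionAlgebra R N) (f 1) x = f 1 := rfl
        rw [mul_apply, h1, h2, indicator_self, mul_one]
      · intro n _ hn
        rw [mul_apply, indicator_of_ne hn.symm, mul_zero]
      · simp)
    (by
      let _ := Fintype.ofFinite N
      refine AlgHom.ext fun f => ?_
      change Algebra.TensorProduct.lift (.id R _) (invHom R N) (fun _ _ => Commute.all _ _)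
        (comulHom R N f) = algebraMap R _ (f 1)
      simp only [comulHom_apply f, map_sum, Algebra.TensorProduct.lift_tmul, AlgHom.id_apply]
      funext x
      rw [sum_apply, Finset.sum_eq_single x⁻¹]
      · have h1 : translates R N f x⁻¹ x = f 1 := congrArg f (mul_inv_cancel x)
        have h2 : algebraMap R (FunctionAlgebra R N) (f 1) x = f 1 := rfl
        rw [mul_apply, h1, h2,
          show invHom R N (indicator R x⁻¹) x = 1 from indicator_self x⁻¹, mul_one]
      · intro n _ hn
        rw [mul_apply, show invHom R N (indicator R n) x = 0 from indicator_of_ne hn.symm,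
          mul_zero]
      · simp)

end FunctionAlgebra

/-- The constant group scheme over `Spec R` attached to a finite group `N`: the spectrum of the
Hopf algebra `R ^ N`, i.e. the disjoint union of copies of `Spec R` indexed by `N`. -/
noncomputable def constantGroup (R : Type u) [CommRing R] (N : Type u) [Group N] [Finite N] :
    Grp (Over (Spec (.of R))) :=
  (hopfSpec (.of R)).obj (.op (.of R (FunctionAlgebra R N)))

/-- The base change `G ×_S T` of a group scheme `G` over `S` along `p : T ⟶ S`, as a group scheme
over `T`. -/
noncomputable def groupBaseChange {S T : Scheme.{u}} (p : T ⟶ S) (G : Grp (Over S)) :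
    Grp (Over T) :=
  (Over.pullback p).mapGrp.obj G

/-- `H` is an `S`-form of `G`: the two group schemes over `S` become isomorphic, as group schemes
over `T`, after base change to some étale cover `T ⟶ S`. -/
def IsForm {S : Scheme.{u}} (H G : Grp (Over S)) : Prop :=
  ∃ (T : Scheme.{u}) (p : T ⟶ S), Etale p ∧ Surjective p ∧
    Nonempty (groupBaseChange p H ≅ groupBaseChange p G)

/-- `G` is the Weil restriction of the group scheme `H` along `f : S' ⟶ S`: it represents the
group functor `T ↦ H (T ×_S S')` on schemes over `S`. -/
def IsWeilRestriction {S' S : Scheme.{u}} (f : S' ⟶ S) (H : Grp (Over S')) (G : Grp (Over S)) :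
    Prop :=
  Nonempty (yonedaGrp.obj G ≅ (Over.pullback f).op ⋙ yonedaGrp.obj H)

/-! ### Automorphisms of powers of an indecomposable centerless group -/

section GroupTheory

variable {N : Type u} [Group N] {ι : Type*} [DecidableEq ι]

/-! A finite Galois extension `L / k` splits `G`, and `Gal(L / k)` then acts by automorphisms on the
group `G(L) = N ^ t`. The theorem rests on the fact that every automorphism of `N ^ t` permutes the
factors when `N` is indecomposable with trivial center (`MulAut.exists_map_mulSingle`,
`exists_permHom_of_mulAut`). This gives an action `s` of the Galois group on `Fin t`, and `A` is the
étale algebra attached to that finite Galois set, realized as the equivariant functions `Fin t → L`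
(`equivariantSubalgebra`).

The twisted form of `N` over `A` is cut out of `G_A` by an idempotent. Put `P = Spec A`, whose
`L`-points are indexed by `Fin t`. The rule `(m, i) ↦ Pi.mulSingle i (m i)` on `L`-points is Galois
equivariant, exactly because the action permutes the factors, so it descends to a morphism `e : G ×
P ⟶ G` (`IsSplit.exists_hom`, `exists_isFactorProjection`). This `e` is a family, parametrized by
`P`, of idempotent endomorphisms of `G`, that is, an idempotent endomorphism of `G_A`. It splits,
and its image is the required group.

Two checks remain, both made on points over `L`. A point of `G` is the same as a `P`-family of
points in the image of `e`, since an element of `N ^ t` is the same as its `t` components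
(`IsFactorProjection.existsUnique`); this is the Weil restriction property. Over the étale cover `P
× Spec L ⟶ P`, the constant group of `N` splits the same idempotent
(`IsFactorProjection.exists_splitting`), hence is isomorphic to the image
(`IsFactorProjection.isForm`). -/

theorem eq_one_of_forall_commute (hcenter : Subgroup.center N = ⊥) {n : N}
    (h : ∀ m, Commute n m) : n = 1 := by
  rw [← Subgroup.mem_bot, ← hcenter, Subgroup.mem_center_iff]
  exact fun m => (h m).symm.eq

/-- An idempotent endomorphism whose range centralizes its kernel exhibits an indecomposable group
as a direct product, hence is trivial or injective. -/
theorem IsIndecomposableGroup.eq_one_or_injective (hindec : IsIndecomposableGroup N)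
    (p : N →* N) (hp : ∀ n, p (p n) = p n) (hc : ∀ n c, p c = 1 → Commute (p n) c) :
    (∀ n, p n = 1) ∨ Function.Injective p := by
  let f : p.range × p.ker →* N := MonoidHom.noncommCoprod p.range.subtype p.ker.subtype (by
    rintro ⟨_, n, rfl⟩ ⟨c, hc'⟩
    exact hc n c hc')
  have hf : Function.Bijective f := by
    refine ⟨(injective_iff_map_eq_one f).2 ?_, fun n => ?_⟩
    · rintro ⟨⟨_, n, rfl⟩, ⟨c, hc'⟩⟩ h
      have h1 : p n * c = 1 := h
      have h2 : p n = 1 := by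
        have := congrArg p h1
        rwa [map_mul, hp, MonoidHom.mem_ker.1 hc', mul_one, map_one] at this
      have h3 : c = 1 := by rwa [h2, one_mul] at h1
      ext <;> simp [h2, h3]
    · refine ⟨⟨⟨p n, n, rfl⟩, ⟨(p n)⁻¹ * n, ?_⟩⟩, ?_⟩
      · simp [MonoidHom.mem_ker, hp]
      · simp [f, MonoidHom.noncommCoprod_apply]
  rcases hindec _ _ ⟨(MulEquiv.ofBijective f hf).symm⟩ with h | h
  · exact .inl fun n => congrArg Subtype.val (Subsingleton.elim (⟨p n, n, rfl⟩ : p.range) 1)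
  · refine .inr ((injective_iff_map_eq_one p).2 fun n hn => ?_)
    exact congrArg Subtype.val (Subsingleton.elim (⟨n, hn⟩ : p.ker) 1)

theorem commute_mulSingle_of_apply {m : ι → N} {j : ι} {n : N} (h : Commute (m j) n) :
    Commute m (Pi.mulSingle j n) := by
  funext l
  by_cases hl : l = j
  · subst hl; simpa using h.eq
  · simp [Pi.mulSingle_eq_of_ne hl]

/-- For `l ≠ i`, the image of factor `l` commutes with that of factor `i`, hence also with the
`j`-component of the latter. Pulling back by `σ`, the preimage of this component commutes with
factor `l`, so its `l`-th entry is central, hence trivial. -/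
theorem MulAut.map_mulSingle_component (hcenter : Subgroup.center N = ⊥) (σ : MulAut (ι → N))
    (i j : ι) (n : N) :
    σ (Pi.mulSingle i (σ⁻¹ (Pi.mulSingle j (σ (Pi.mulSingle i n) j)) i)) =
      Pi.mulSingle j (σ (Pi.mulSingle i n) j) := by
  suffices h : σ⁻¹ (Pi.mulSingle j (σ (Pi.mulSingle i n) j)) =
      Pi.mulSingle i (σ⁻¹ (Pi.mulSingle j (σ (Pi.mulSingle i n) j)) i) by
    rw [← h, MulAut.apply_inv_self]
  set z := σ⁻¹ (Pi.mulSingle j (σ (Pi.mulSingle i n) j)) with hz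
  funext l
  by_cases hl : l = i
  · subst hl; simp
  rw [Pi.mulSingle_eq_of_ne hl]
  refine eq_one_of_forall_commute hcenter fun n' => ?_
  have h1 : Commute (σ (Pi.mulSingle l n')) (σ (Pi.mulSingle i n)) :=
    (Pi.mulSingle_commute hl n' n).map σ
  have h2 : Commute (σ (Pi.mulSingle l n')) (Pi.mulSingle j (σ (Pi.mulSingle i n) j)) :=
    commute_mulSingle_of_apply (congrFun h1 j)
  have h3 : Commute (Pi.mulSingle l n') z := by
    simpa [hz] using h2.map σ⁻¹
  simpa [commute_iff_eq] using (congrFun h3 l).symm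

/-- The composite `p j` from factor `i` to factor `j` via `σ` and back via `σ⁻¹` is an idempotent
endomorphism of `N` whose range centralizes its kernel, so indecomposability makes it trivial or
injective. -/
theorem MulAut.exists_map_mulSingle [Nontrivial N] (hindec : IsIndecomposableGroup N)
    (hcenter : Subgroup.center N = ⊥) (σ : MulAut (ι → N)) (i : ι) :
    ∃ j, ∀ n, σ (Pi.mulSingle i n) = Pi.mulSingle j (σ (Pi.mulSingle i n) j) := by
  let p (j : ι) : N →* N := (Pi.evalMonoidHom (fun _ : ι => N) i).comp
    ((σ⁻¹ : MulAut (ι → N)).toMonoidHom.comp ((MonoidHom.mulSingle (fun _ : ι => N) j).comp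
      ((Pi.evalMonoidHom (fun _ : ι => N) j).comp
        (σ.toMonoidHom.comp (MonoidHom.mulSingle (fun _ : ι => N) i)))))
  have hσp (j n) : σ (Pi.mulSingle i (p j n)) = Pi.mulSingle j (σ (Pi.mulSingle i n) j) :=
    σ.map_mulSingle_component hcenter i j n
  have hp (j n) : p j (p j n) = p j n := by
    have h : Pi.mulSingle (M := fun _ => N) i (p j (p j n)) = Pi.mulSingle i (p j n) := by
      apply σ.injective
      rw [hσp, hσp, Pi.mulSingle_eq_same]
    simpa using congrFun h i
  have hker (j c) (hc : p j c = 1) : σ (Pi.mulSingle i c) j = 1 := by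
    have := congrFun (hσp j c) j
    simpa [hc] using this.symm
  have hc (j n c) (hc : p j c = 1) : Commute (p j n) c := by
    have h1 : Commute (σ (Pi.mulSingle i c)) (σ (Pi.mulSingle i (p j n))) := by
      rw [hσp]
      exact commute_mulSingle_of_apply (by simp [hker j c hc])
    have h2 := h1.map σ⁻¹
    simpa [commute_iff_eq] using (congrFun h2 i).symm
  -- If every `p j` were trivial, `σ` would kill the whole factor `i`.
  obtain ⟨j, hj⟩ : ∃ j, Function.Injective (p j) := by
    by_contra! h
    obtain ⟨n, hn⟩ := exists_ne (1 : N)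
    refine hn ?_
    have h1 : σ (Pi.mulSingle i n) = 1 := by
      funext j
      exact hker j n
        ((hindec.eq_one_or_injective (p j) (hp j) (hc j)).resolve_right (h j) n)
    have h2 : Pi.mulSingle (M := fun _ => N) i n = 1 := σ.injective (by rw [h1, map_one])
    simpa using congrFun h2 i
  refine ⟨j, fun n => ?_⟩
  -- An injective idempotent is the identity.
  rw [← hσp, hj (hp j n)]

/-- Sending factor `i` into factor `j` is upgraded to compatibility with the projections. By the
same result for `σ⁻¹`, factor `j` comes back into factor `i`. Then `m` with its `i`-th entry removed
commutes with the preimage of factor `j`, so the `j`-th entry of its image is central, hence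
trivial. -/
theorem MulAut.exists_map_projection [Nontrivial N] (hindec : IsIndecomposableGroup N)
    (hcenter : Subgroup.center N = ⊥) (σ : MulAut (ι → N)) (i : ι) :
    ∃ j, ∀ m, σ (Pi.mulSingle i (m i)) = Pi.mulSingle j (σ m j) := by
  obtain ⟨j, hj⟩ := σ.exists_map_mulSingle hindec hcenter i
  obtain ⟨i', hi'⟩ := σ⁻¹.exists_map_mulSingle hindec hcenter j
  have hi : i' = i := by
    obtain ⟨n, hn⟩ := exists_ne (1 : N)
    by_contra h
    have h1 := congrFun (hi' (σ (Pi.mulSingle i n) j)) i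
    rw [Pi.mulSingle_eq_of_ne (Ne.symm h), ← hj, MulAut.inv_apply_self, Pi.mulSingle_eq_same] at h1
    exact hn h1
  subst hi
  refine ⟨j, fun m => ?_⟩
  have h1 : σ ((Pi.mulSingle i' (m i'))⁻¹ * m) j = 1 := by
    refine eq_one_of_forall_commute hcenter fun n => ?_
    have h2 : Commute ((Pi.mulSingle i' (m i'))⁻¹ * m) (σ⁻¹ (Pi.mulSingle j n)) := by
      rw [hi']
      exact commute_mulSingle_of_apply (by simp)
    have h3 := h2.map σ
    rw [MulAut.apply_inv_self] at h3
    simpa [commute_iff_eq] using congrFun h3 j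
  rw [hj]
  congr 1
  rw [map_mul, map_inv, Pi.mul_apply, Pi.inv_apply] at h1
  exact inv_mul_eq_one.1 h1

/-- A group acting by automorphisms on a power of an indecomposable group with trivial center
permutes the factors. -/
theorem exists_permHom_of_mulAut (hindec : IsIndecomposableGroup N)
    (hcenter : Subgroup.center N = ⊥) {Γ : Type*} [Group Γ] (ρ : Γ →* MulAut (ι → N)) :
    ∃ s : Γ →* Equiv.Perm ι, ∀ γ i m,
      ρ γ (Pi.mulSingle i (m i)) = Pi.mulSingle (s γ i) (ρ γ m (s γ i)) := by
  rcases subsingleton_or_nontrivial N with hN | hN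
  -- For trivial `N` the target factor is not unique, but any action will do.
  · exact ⟨1, fun _ _ _ => Subsingleton.elim _ _⟩
  choose s hs using fun γ i => (ρ γ).exists_map_projection hindec hcenter i
  have huniq (σ : MulAut (ι → N)) (i j j' : ι)
      (hj : ∀ m, σ (Pi.mulSingle i (m i)) = Pi.mulSingle j (σ m j))
      (hj' : ∀ m, σ (Pi.mulSingle i (m i)) = Pi.mulSingle j' (σ m j')) : j = j' := by
    by_contra h
    obtain ⟨n, hn⟩ := exists_ne (1 : N)
    have h1 : σ (Pi.mulSingle i n) j = 1 := by
      have := hj' (Pi.mulSingle i n)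
      rw [Pi.mulSingle_eq_same] at this
      rw [this, Pi.mulSingle_eq_of_ne h]
    have h2 : σ (Pi.mulSingle i n) = 1 := by
      have := hj (Pi.mulSingle i n)
      rw [Pi.mulSingle_eq_same] at this
      rw [this, h1, Pi.mulSingle_one]
    have h3 : Pi.mulSingle (M := fun _ => N) i n = 1 := σ.injective (by rw [h2, map_one])
    exact hn (by simpa using congrFun h3 i)
  -- Uniqueness of the target factor makes `s` multiplicative; as `Γ` is a group, its values are
  -- then permutations.
  let f : Γ →* Function.End ι :=
    { toFun := s
      map_one' := by
        funext i
        exact huniq 1 i _ _ (by simpa using hs 1 i) (fun m => rfl)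
      map_mul' := fun γ δ => by
        funext i
        refine huniq (ρ (γ * δ)) i _ _ (hs _ i) fun m => ?_
        rw [map_mul, MulAut.mul_apply, hs δ, hs γ]
        rfl }
  exact ⟨f.toHomPerm, fun γ i m => hs γ i m⟩

end GroupTheory

/-! ### Split objects and Galois descent of morphisms -/

section SplitObjects

open MonoidalCategory CartesianMonoidalCategory MonObj

universe v w

variable {C : Type w} [Category.{v} C] [CartesianMonoidalCategory C]

/-- `X` is split over `Λ` by the points `x j : Λ ⟶ X` if, for all `T` over `Λ`, the product
`X ⊗ T` is the disjoint union of the copies of `T` given by the points `x j`. -/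
def IsSplit (Λ X : C) {J : Type*} (x : J → (Λ ⟶ X)) : Prop :=
  ∀ ⦃T Y : C⦄ (τ : T ⟶ Λ) (y : J → (T ⟶ Y)),
    ∃! h : X ⊗ T ⟶ Y, ∀ j, lift (τ ≫ x j) (𝟙 T) ≫ h = y j

/-- Morphisms descend along the projections `T ⊗ Λ ⟶ T`. -/
def Descends (Λ : C) : Prop :=
  ∀ ⦃T Y : C⦄ (h : T ⊗ Λ ⟶ Y), T ◁ fst Λ Λ ≫ h = T ◁ snd Λ Λ ≫ h →
    ∃! g : T ⟶ Y, fst T Λ ≫ g = h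

variable {Λ X X' T Y : C} {J J' : Type*} {x : J → (Λ ⟶ X)} {x' : J' → (Λ ⟶ X')}

theorem IsSplit.hom_ext (hx : IsSplit Λ X x) (τ : T ⟶ Λ) {f g : X ⊗ T ⟶ Y}
    (h : ∀ j, lift (τ ≫ x j) (𝟙 T) ≫ f = lift (τ ≫ x j) (𝟙 T) ≫ g) : f = g :=
  (hx τ fun j => lift (τ ≫ x j) (𝟙 T) ≫ g).unique h fun _ => rfl

theorem IsSplit.prod (hx : IsSplit Λ X x) (hx' : IsSplit Λ X' x') :
    IsSplit Λ (X ⊗ X') fun j : J × J' => lift (x j.1) (x' j.2) := by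
  intro T Y τ y
  choose h hh _ using fun j => hx' τ fun j' => y (j, j')
  obtain ⟨g, hg, _⟩ := hx (snd X' T ≫ τ) h
  refine ⟨(α_ X X' T).hom ≫ g, ?_, fun g' hg' => ?_⟩
  · rintro ⟨j, j'⟩
    rw [← hh, ← hg, ← Category.assoc, ← Category.assoc]
    congr 1
    ext <;> simp
  · rw [← Iso.inv_comp_eq]
    refine hx.hom_ext (snd X' T ≫ τ) fun j => ?_
    rw [hg]
    refine hx'.hom_ext τ fun j' => ?_
    rw [hh, ← hg']
    simp only [← Category.assoc]
    congr 1
    ext <;> simp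

theorem Descends.cancel (hΛ : Descends Λ) {f g : T ⟶ Y} (h : fst T Λ ≫ f = fst T Λ ≫ g) :
    f = g :=
  (hΛ (fst T Λ ≫ g) (by simp)).unique h rfl

/-- The points of a split object are jointly epimorphic. -/
theorem IsSplit.hom_ext_points (hΛ : Descends Λ) (hx : IsSplit Λ X x) {f g : X ⟶ Y}
    (h : ∀ j, x j ≫ f = x j ≫ g) : f = g :=
  hΛ.cancel (hx.hom_ext (𝟙 Λ) fun j => by simp [h])

/-- Galois descent: an equivariant map on points comes from a morphism. -/
theorem IsSplit.exists_hom (hΛ : Descends Λ) {Γ : Type*} [Group Γ] {a : Γ → (Λ ⟶ Λ)}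
    (ha : IsSplit Λ Λ a) (hx : IsSplit Λ X x) (s : Γ → J → J)
    (hs : ∀ c j, a c ≫ x j = x (s c j)) (hss : ∀ c j, s c (s c⁻¹ j) = j)
    (u : J → (Λ ⟶ Y)) (hu : ∀ c j, a c ≫ u j = u (s c j)) :
    ∃ g : X ⟶ Y, ∀ j, x j ≫ g = u j := by
  obtain ⟨h, hh, _⟩ := hx (𝟙 Λ) u
  simp only [Category.id_comp] at hh
  -- Equivariance says that `h` is constant along the Galois orbit of the second coordinate.
  have key (c j) : lift (x j) (a c) ≫ h = u j := by
    have : lift (x j) (a c) = a c ≫ lift (x (s c⁻¹ j)) (𝟙 Λ) := by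
      ext <;> simp [hs, hss]
    rw [this, Category.assoc, hh, hu, hss]
  -- The descent condition lives on `X ⊗ (Λ ⊗ Λ)`, which is split with index set `J × Γ`; at `(j,
  -- c)` both sides are `u j`.
  obtain ⟨g, hg, _⟩ := hΛ h (by
    refine hx.hom_ext (snd Λ Λ) fun j => ?_
    refine ha.hom_ext (𝟙 Λ) fun c => ?_
    have h1 : lift (𝟙 Λ ≫ a c) (𝟙 Λ) ≫ lift (snd Λ Λ ≫ x j) (𝟙 (Λ ⊗ Λ)) ≫ X ◁ fst Λ Λ =
        lift (x j) (a c) := by ext <;> simp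
    have h2 : lift (𝟙 Λ ≫ a c) (𝟙 Λ) ≫ lift (snd Λ Λ ≫ x j) (𝟙 (Λ ⊗ Λ)) ≫ X ◁ snd Λ Λ =
        lift (x j) (𝟙 Λ) := by ext <;> simp
    have h3 := congrArg (· ≫ h) h1
    have h4 := congrArg (· ≫ h) h2
    simp only [Category.assoc, key, hh] at h3 h4
    rw [h3, h4])
  refine ⟨g, fun j => ?_⟩
  rw [← hh, ← hg, ← Category.assoc, lift_fst]

end SplitObjects

/-! ### The projections of `G` to its factors, as one family over `P` -/

section FactorProjection

open MonoidalCategory CartesianMonoidalCategory MonObj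

universe v w

variable {C : Type w} [Category.{v} C] [CartesianMonoidalCategory C]
  {Λ G H P : C} [GrpObj G] [GrpObj H] {N : Type*} [Group N] {t : ℕ}

theorem prod_ofFn_apply_mulSingle (j : Fin t) (a : N) :
    (List.ofFn fun i => Pi.mulSingle (M := fun _ => N) i a j).prod = a := by
  induction t with
  | zero => exact j.elim0
  | succ t ih =>
    rw [List.ofFn_succ, List.prod_cons]
    refine Fin.cases ?_ (fun j => ?_) j
    · simp
    · have h (i : Fin t) : Pi.mulSingle (M := fun _ => N) i.succ a j.succ =
          Pi.mulSingle (M := fun _ => N) i a j := by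
        simp [Pi.mulSingle_apply]
      simp only [h, ih]
      rw [Pi.mulSingle_eq_of_ne (Fin.succ_ne_zero j), _root_.one_mul]

theorem prod_ofFn_mulSingle (m : Fin t → N) :
    (List.ofFn fun i => Pi.mulSingle i (m i)).prod = m := by
  funext j
  have h := map_list_prod (Pi.evalMonoidHom (fun _ : Fin t => N) j)
    (List.ofFn fun i => Pi.mulSingle i (m i))
  rw [Pi.evalMonoidHom_apply] at h
  rw [h, List.map_ofFn, ← prod_ofFn_apply_mulSingle j (m j)]
  congr 2
  funext i
  by_cases hij : j = i
  · subst hij; simp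
  · simp [Pi.mulSingle_eq_of_ne hij]

/-- A morphism `φ : H ⊗ P ⟶ G` is multiplicative if it is a family of homomorphisms `H ⟶ G`
parametrized by `P`. -/
def IsMultiplicative (φ : H ⊗ P ⟶ G) : Prop :=
  ∀ ⦃T : C⦄ (a b : T ⟶ H) (s : T ⟶ P),
    lift (a * b) s ≫ φ = (lift a s ≫ φ) * (lift b s ≫ φ)

/-- It suffices to treat the universal pair of points, parametrized by `(H ⊗ H) ⊗ P`. This object is
again split, so its `Λ`-points are jointly epimorphic. -/
theorem IsMultiplicative.of_points (hΛ : Descends Λ) {M I : Type*} [Group M]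
    {x : M →* (Λ ⟶ H)} (hx : IsSplit Λ H x) {p : I → (Λ ⟶ P)} (hp : IsSplit Λ P p)
    (φ : H ⊗ P ⟶ G)
    (h : ∀ m n i, lift (x (m * n)) (p i) ≫ φ = (lift (x m) (p i) ≫ φ) * (lift (x n) (p i) ≫ φ)) :
    IsMultiplicative φ := by
  have key : lift (fst (H ⊗ H) P ≫ fst H H * fst (H ⊗ H) P ≫ snd H H) (snd (H ⊗ H) P) ≫ φ =
      (lift (fst (H ⊗ H) P ≫ fst H H) (snd (H ⊗ H) P) ≫ φ) *
        (lift (fst (H ⊗ H) P ≫ snd H H) (snd (H ⊗ H) P) ≫ φ) := by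
    refine ((hx.prod hx).prod hp).hom_ext_points hΛ ?_
    rintro ⟨⟨m, n⟩, i⟩
    simp only [comp_mul, comp_lift_assoc, lift_fst_assoc, lift_fst, lift_snd]
    rw [← map_mul, h]
  intro T a b s
  have := congrArg (fun f => lift (lift a b) s ≫ f) key
  simpa only [comp_mul, comp_lift_assoc, lift_fst_assoc, lift_fst, lift_snd] using this

/-- A morphism `e : G ⊗ P ⟶ G` that, on points, projects `N ^ t` to its factors. -/
structure IsFactorProjection (x : (Fin t → N) →* (Λ ⟶ G)) (p : Fin t → (Λ ⟶ P))
    (e : G ⊗ P ⟶ G) : Prop where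
  descends : Descends Λ
  split : IsSplit Λ G x
  split' : IsSplit Λ P p
  comp : ∀ m i, lift (x m) (p i) ≫ e = x (Pi.mulSingle i (m i))

namespace IsFactorProjection

variable {x : (Fin t → N) →* (Λ ⟶ G)} {p : Fin t → (Λ ⟶ P)} {e : G ⊗ P ⟶ G}
  (he : IsFactorProjection x p e)
include he

theorem isMultiplicative : IsMultiplicative e :=
  .of_points he.descends he.split he.split' e fun m n i => by
    rw [he.comp, he.comp, he.comp, ← map_mul, Pi.mul_apply, Pi.mulSingle_mul]

theorem idem ⦃T : C⦄ (a : T ⟶ G) (s : T ⟶ P) : lift (lift a s ≫ e) s ≫ e = lift a s ≫ e := by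
  have key : lift e (snd G P) ≫ e = e := by
    refine (he.split.prod he.split').hom_ext_points he.descends ?_
    rintro ⟨m, i⟩
    simp only [comp_lift_assoc, lift_snd, he.comp, Pi.mulSingle_eq_same]
  have := congrArg (fun f => lift a s ≫ f) key
  simpa only [comp_lift_assoc, lift_snd] using this

/-- Reduces identities for arbitrary points of `G` over `Λ` to identities in `N ^ t`: the pair `(a,
τ)` is pulled back from the universal one on `G ⊗ Λ`. -/
theorem hom_ext_of_points {Y T : C} (τ : T ⟶ Λ) {f g : G ⊗ Λ ⟶ Y}
    (h : ∀ m, lift (x m) (𝟙 Λ) ≫ f = lift (x m) (𝟙 Λ) ≫ g) (a : T ⟶ G) :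
    lift a τ ≫ f = lift a τ ≫ g := by
  rw [he.split.hom_ext (𝟙 Λ) (f := f) (g := g) (by simpa using h)]

theorem comp_of_ne {i j : Fin t} (hij : i ≠ j) ⦃T : C⦄ (τ : T ⟶ Λ) (a : T ⟶ G) :
    lift (lift a (τ ≫ p j) ≫ e) (τ ≫ p i) ≫ e = 1 := by
  have := he.hom_ext_of_points τ (f := lift (lift (fst G Λ) (snd G Λ ≫ p j) ≫ e)
    (snd G Λ ≫ p i) ≫ e) (g := 1) (fun m => by
      simp only [comp_lift_assoc, lift_snd_assoc, lift_fst, Category.id_comp, he.comp, comp_one]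
      rw [Pi.mulSingle_eq_of_ne hij, Pi.mulSingle_one, map_one]) a
  simpa only [comp_lift_assoc, lift_snd_assoc, lift_fst, comp_one] using this

theorem prod_eq ⦃T : C⦄ (τ : T ⟶ Λ) (a : T ⟶ G) :
    (List.ofFn fun i => lift a (τ ≫ p i) ≫ e).prod = a := by
  have hcomp {U V : C} (f : U ⟶ V) (y : Fin t → (V ⟶ G)) :
      f ≫ (List.ofFn y).prod = (List.ofFn fun i => f ≫ y i).prod := by
    let φ : (V ⟶ G) →* (U ⟶ G) := ⟨⟨fun g => f ≫ g, comp_one f⟩, comp_mul f⟩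
    exact (map_list_prod φ _).trans (by rw [List.map_ofFn]; rfl)
  have := he.hom_ext_of_points τ (f := (List.ofFn fun i =>
      lift (fst G Λ) (snd G Λ ≫ p i) ≫ e).prod) (g := fst G Λ) (fun m => by
    rw [hcomp]
    simp only [comp_lift_assoc, lift_snd_assoc, lift_fst, Category.id_comp, he.comp]
    have h1 : List.ofFn (fun i => x (Pi.mulSingle i (m i))) =
        (List.ofFn fun i => Pi.mulSingle i (m i)).map x := by rw [List.map_ofFn]; rfl
    rw [h1, ← map_list_prod]
    rw [prod_ofFn_mulSingle]) a
  rw [hcomp] at this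
  simpa only [comp_lift_assoc, lift_snd_assoc, lift_fst, comp_one] using this

/-- `G` is the Weil restriction of the image of `e`, for objects over `Λ`. -/
theorem existsUnique_of_hom ⦃T : C⦄ (τ : T ⟶ Λ) (y : T ⊗ P ⟶ G)
    (hy : lift y (snd T P) ≫ e = y) : ∃! a : T ⟶ G, lift (fst T P ≫ a) (snd T P) ≫ e = y := by
  let σ (i : Fin t) : T ⟶ T ⊗ P := lift (𝟙 T) (τ ≫ p i)
  have hσ (a : T ⟶ G) (i) : σ i ≫ lift (fst T P ≫ a) (snd T P) ≫ e = lift a (τ ≫ p i) ≫ e := by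
    simp [σ, comp_lift_assoc]
  -- Since `P` is split, `T ⊗ P` is the disjoint union of `t` copies of `T`, included by the `σ i`.
  have hext {f g : T ⊗ P ⟶ G} (h : ∀ i, σ i ≫ f = σ i ≫ g) : f = g := by
    have h1 : lift (snd P T) (fst P T) ≫ f = lift (snd P T) (fst P T) ≫ g :=
      he.split'.hom_ext τ fun i => by
        have : lift (τ ≫ p i) (𝟙 T) ≫ lift (snd P T) (fst P T) = σ i := by
          ext <;> simp [σ]
        rw [← Category.assoc, ← Category.assoc, this, h]
    have h2 := congrArg (fun f => lift (snd T P) (fst T P) ≫ f) h1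
    have h3 : lift (snd T P) (fst T P) ≫ lift (snd P T) (fst P T) = 𝟙 _ := by ext <;> simp
    simpa only [← Category.assoc, h3, Category.id_comp] using h2
  have hyi (i) : lift (σ i ≫ y) (τ ≫ p i) ≫ e = σ i ≫ y := by
    conv_rhs => rw [← hy]
    simp [σ, comp_lift_assoc]
  have hmul (i) (l : List (T ⟶ G)) : lift l.prod (τ ≫ p i) ≫ e =
      (l.map fun a => lift a (τ ≫ p i) ≫ e).prod := by
    induction l with
    | nil =>
      have := he.isMultiplicative (1 : T ⟶ G) 1 (τ ≫ p i)
      simpa using this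
    | cons a l ih => simp [he.isMultiplicative a l.prod, ih]
  -- The point is the product of its prescribed components; `List.ofFn` fixes an order, as the group
  -- of points need not be commutative.
  refine ⟨(List.ofFn fun i => σ i ≫ y).prod, hext fun i => ?_, fun a ha => ?_⟩
  · rw [hσ, hmul, List.map_ofFn]
    conv_rhs => rw [← he.prod_eq τ (σ i ≫ y)]
    -- Both sides are ordered products over `j`, whose entries with `j ≠ i` are trivial.
    congr 2
    funext j
    by_cases hij : i = j
    · subst hij; rfl
    · have h1 := he.comp_of_ne hij τ (σ j ≫ y)
      have h2 := he.comp_of_ne (Ne.symm hij) τ (σ i ≫ y)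
      rw [hyi] at h1 h2
      simp [h1, h2]
  · rw [← he.prod_eq τ a]
    congr 2
    funext i
    rw [← hσ, ha]

/-- `G` is the Weil restriction of the image of `e`. -/
theorem existsUnique ⦃T : C⦄ (y : T ⊗ P ⟶ G)
    (hy : lift y (snd T P) ≫ e = y) : ∃! a : T ⟶ G, lift (fst T P ≫ a) (snd T P) ≫ e = y := by
  have hpull {U V : C} (f : U ⟶ V) (a : V ⟶ G) :
      f ▷ P ≫ lift (fst V P ≫ a) (snd V P) ≫ e = lift (fst U P ≫ f ≫ a) (snd U P) ≫ e := by
    simp [comp_lift_assoc]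
  have hy' {U : C} (f : U ⟶ T) : lift (f ▷ P ≫ y) (snd U P) ≫ e = f ▷ P ≫ y := by
    conv_rhs => rw [← hy]
    simp [comp_lift_assoc]
  -- Solve the problem after pulling back to `T ⊗ Λ`. The solution descends because its two
  -- pullbacks to `T ⊗ (Λ ⊗ Λ)` solve the same problem, where uniqueness is known.
  obtain ⟨b, hb, hb'⟩ := he.existsUnique_of_hom (snd T Λ) (fst T Λ ▷ P ≫ y) (hy' _)
  obtain ⟨a, ha, -⟩ := he.descends b (by
    refine (he.existsUnique_of_hom (snd T (Λ ⊗ Λ) ≫ fst Λ Λ)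
      ((fst T (Λ ⊗ Λ)) ▷ P ≫ y) (hy' _)).unique ?_ ?_
    all_goals
      rw [← hpull, hb, ← Category.assoc, ← comp_whiskerRight]
      simp)
  refine ⟨a, ?_, fun a' ha' => ?_⟩
  · have hcancel {f g : T ⊗ P ⟶ G} (h : fst T Λ ▷ P ≫ f = fst T Λ ▷ P ≫ g) : f = g := by
      refine he.descends.cancel ?_
      have h1 := congrArg (fun f => lift (lift (fst (T ⊗ P) Λ ≫ fst T P) (snd (T ⊗ P) Λ))
        (fst (T ⊗ P) Λ ≫ snd T P) ≫ f) h
      have h2 : lift (lift (fst (T ⊗ P) Λ ≫ fst T P) (snd (T ⊗ P) Λ))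
        (fst (T ⊗ P) Λ ≫ snd T P) ≫ fst T Λ ▷ P = fst (T ⊗ P) Λ := by ext <;> simp
      simpa only [← Category.assoc, h2] using h1
    refine hcancel ?_
    rw [hpull, ha, hb]
  · refine he.descends.cancel ?_
    rw [ha]
    refine hb' _ ?_
    simp only [← hpull, ha']

end IsFactorProjection

end FactorProjection

/-! ### Splitting of forms, and construction of the factor projection -/

section SplitGroups

open MonoidalCategory CartesianMonoidalCategory MonObj

universe v w

variable {C : Type w} [Category.{v} C] [CartesianMonoidalCategory C]
  {Λ X Y P G H : C} {J I : Type*}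

/-- The factor `Λ` in the source makes it a disjoint union of copies of `Λ`, so morphisms are
prescribed freely, without equivariance or descent. It serves to trivialize the image of `e` over `P
⊗ Λ`. -/
theorem IsSplit.existsUnique_prod {x : J → (Λ ⟶ X)} {p : I → (Λ ⟶ P)}
    (hx : IsSplit Λ X x) (hp : IsSplit Λ P p) (y : J → I → (Λ ⟶ Y)) :
    ∃! h : X ⊗ (P ⊗ Λ) ⟶ Y, ∀ j i, lift (x j) (lift (p i) (𝟙 Λ)) ≫ h = y j i := by
  obtain ⟨h, hh, hu⟩ := hx.prod hp (𝟙 Λ) fun ji => y ji.1 ji.2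
  have hα (j : J) (i : I) : lift (x j) (lift (p i) (𝟙 Λ)) =
      lift (𝟙 Λ ≫ lift (x j) (p i)) (𝟙 Λ) ≫ (α_ X P Λ).hom := by ext <;> simp
  refine ⟨(α_ X P Λ).inv ≫ h, fun j i => ?_, fun h' hh' => ?_⟩
  · rw [hα, Category.assoc, Iso.hom_inv_id_assoc, hh (j, i)]
  · rw [Iso.eq_inv_comp]
    refine hu _ fun ji => ?_
    rw [← hh' ji.1 ji.2, hα, Category.assoc]

theorem IsSplit.hom_ext_prod {x : J → (Λ ⟶ X)} {p : I → (Λ ⟶ P)}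
    (hx : IsSplit Λ X x) (hp : IsSplit Λ P p) {f g : X ⊗ (P ⊗ Λ) ⟶ Y}
    (h : ∀ j i, lift (x j) (lift (p i) (𝟙 Λ)) ≫ f = lift (x j) (lift (p i) (𝟙 Λ)) ≫ g) :
    f = g :=
  (hx.existsUnique_prod hp _).unique h fun _ _ => rfl

variable [GrpObj G] [GrpObj H]

theorem IsMultiplicative.of_points_prod {M : Type*} [Group M]
    {x : M →* (Λ ⟶ H)} (hx : IsSplit Λ H x) {p : I → (Λ ⟶ P)} (hp : IsSplit Λ P p)
    (φ : H ⊗ (P ⊗ Λ) ⟶ G)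
    (h : ∀ m n i, lift (x (m * n)) (lift (p i) (𝟙 Λ)) ≫ φ =
      (lift (x m) (lift (p i) (𝟙 Λ)) ≫ φ) * (lift (x n) (lift (p i) (𝟙 Λ)) ≫ φ)) :
    IsMultiplicative φ := by
  have key : lift (fst (H ⊗ H) (P ⊗ Λ) ≫ fst H H * fst (H ⊗ H) (P ⊗ Λ) ≫ snd H H)
        (snd (H ⊗ H) (P ⊗ Λ)) ≫ φ =
      (lift (fst (H ⊗ H) (P ⊗ Λ) ≫ fst H H) (snd (H ⊗ H) (P ⊗ Λ)) ≫ φ) *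
        (lift (fst (H ⊗ H) (P ⊗ Λ) ≫ snd H H) (snd (H ⊗ H) (P ⊗ Λ)) ≫ φ) := by
    refine (hx.prod hx).hom_ext_prod hp ?_
    rintro ⟨m, n⟩ i
    simp only [comp_mul, comp_lift_assoc, lift_fst_assoc, lift_fst, lift_snd]
    rw [← map_mul, h]
  intro T a b s
  have := congrArg (fun f => lift (lift a b) s ≫ f) key
  simpa only [comp_mul, comp_lift_assoc, lift_fst_assoc, lift_fst, lift_snd] using this

/-- If `G` and `H` become isomorphic as groups over `Λ` and `H` is split, so is `G`. -/
theorem IsSplit.of_mulEquiv {M : Type*} [Group M] {y : M →* (Λ ⟶ H)} (hy : IsSplit Λ H y)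
    (Φ : ∀ U : C, (U ⟶ Λ) → ((U ⟶ G) ≃* (U ⟶ H)))
    (hΦ : ∀ (U V : C) (f : U ⟶ V) (τ : V ⟶ Λ) (g : V ⟶ G),
      Φ U (f ≫ τ) (f ≫ g) = f ≫ Φ V τ g) :
    IsSplit Λ G ((Φ Λ (𝟙 Λ)).symm.toMonoidHom.comp y) := by
  have hΦ' (U V : C) (f : U ⟶ V) (τ : V ⟶ Λ) (g : V ⟶ H) :
      (Φ U (f ≫ τ)).symm (f ≫ g) = f ≫ (Φ V τ).symm g := by
    rw [MulEquiv.symm_apply_eq, hΦ, MulEquiv.apply_symm_apply]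
  intro T Y τ z
  let A : G ⊗ T ⟶ H ⊗ T := lift (Φ _ (snd G T ≫ τ) (fst G T)) (snd G T)
  let B : H ⊗ T ⟶ G ⊗ T := lift ((Φ _ (snd H T ≫ τ)).symm (fst H T)) (snd H T)
  have hAB : A ≫ B = 𝟙 _ := by
    ext
    · simp only [Category.assoc, B, lift_fst, Category.id_comp]
      rw [← hΦ']
      simp [A]
    · simp [A, B]
  have hA (m) : lift (τ ≫ (Φ Λ (𝟙 Λ)).symm (y m)) (𝟙 T) ≫ A = lift (τ ≫ y m) (𝟙 T) := by
    ext
    · simp only [Category.assoc, A, lift_fst]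
      rw [← hΦ]
      simp only [lift_snd_assoc, lift_fst, Category.id_comp]
      simpa using hΦ T Λ τ (𝟙 Λ) ((Φ Λ (𝟙 Λ)).symm (y m))
    · simp [A]
  have hB (m) : lift (τ ≫ y m) (𝟙 T) ≫ B = lift (τ ≫ (Φ Λ (𝟙 Λ)).symm (y m)) (𝟙 T) := by
    rw [← hA, Category.assoc, hAB, Category.comp_id]
  obtain ⟨h, hh, hu⟩ := hy τ z
  refine ⟨A ≫ h, fun m => ?_, fun h' hh' => ?_⟩
  · rw [← hh m, ← hA, Category.assoc]; rfl
  · rw [← hu (B ≫ h') fun m => ?_, ← Category.assoc, hAB, Category.id_comp]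
    rw [← Category.assoc, hB]
    exact hh' m

/-- The group `Γ` permutes the factors of the group `N ^ t` of `Λ`-valued points of `G`. -/
theorem exists_permHom_of_points {N : Type u} [Group N] (hindec : IsIndecomposableGroup N)
    (hcenter : Subgroup.center N = ⊥) {t : ℕ} {Γ : Type*} [Group Γ] {a : Γ → (Λ ⟶ Λ)}
    (ha1 : a 1 = 𝟙 Λ) (hamul : ∀ c d, a (c * d) = a c ≫ a d) (x : (Fin t → N) ≃* (Λ ⟶ G)) :
    ∃ (ρ : Γ → (Fin t → N) → (Fin t → N)) (s : Γ →* Equiv.Perm (Fin t)),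
      (∀ c m, a c ≫ x m = x (ρ c m)) ∧ (∀ c m, ρ c (ρ c⁻¹ m) = m) ∧ ∀ c i m,
        ρ c (Pi.mulSingle i (m i)) = Pi.mulSingle (s c i) (ρ c m (s c i)) := by
  let f (c : Γ) : (Λ ⟶ G) →* (Λ ⟶ G) := ⟨⟨fun g => a c ≫ g, comp_one (a c)⟩, comp_mul (a c)⟩
  have hf (c d) (g : Λ ⟶ G) : f c (f d g) = f (c * d) g := by simp [f, hamul]
  have hf1 (g : Λ ⟶ G) : f 1 g = g := by simp [f, ha1]
  let ρ : Γ →* MulAut (Fin t → N) :=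
    { toFun := fun c =>
        { toFun := fun m => x.symm (f c (x m))
          invFun := fun m => x.symm (f c⁻¹ (x m))
          left_inv := fun m => by simp [hf, hf1]
          right_inv := fun m => by simp [hf, hf1]
          map_mul' := fun m n => by simp }
      map_one' := by ext m : 1; simp [hf1]
      map_mul' := fun c d => by ext m : 1; simp [hf] }
  obtain ⟨s, hs⟩ := exists_permHom_of_mulAut hindec hcenter ρ
  refine ⟨fun c => ρ c, s, fun c m => (x.apply_symm_apply _).symm, fun c m => ?_, hs⟩
  change (ρ c * ρ c⁻¹) m = m
  rw [← map_mul, mul_inv_cancel, map_one, MulAut.one_apply]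

/-- Galois descent applied to `(m, i) ↦ Pi.mulSingle i (m i)`; `hρs` is precisely its equivariance.
-/
theorem exists_isFactorProjection {N : Type*} [Group N] {t : ℕ} (hΛ : Descends Λ)
    {Γ : Type*} [Group Γ] {a : Γ → (Λ ⟶ Λ)} (ha : IsSplit Λ Λ a)
    {x : (Fin t → N) →* (Λ ⟶ G)} (hx : IsSplit Λ G x) {p : Fin t → (Λ ⟶ P)}
    (hp : IsSplit Λ P p) {ρ : Γ → (Fin t → N) → (Fin t → N)} {s : Γ →* Equiv.Perm (Fin t)}
    (hρ : ∀ c m, a c ≫ x m = x (ρ c m)) (hρρ : ∀ c m, ρ c (ρ c⁻¹ m) = m)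
    (hs : ∀ c i, a c ≫ p i = p (s c i))
    (hρs : ∀ c i m, ρ c (Pi.mulSingle i (m i)) = Pi.mulSingle (s c i) (ρ c m (s c i))) :
    ∃ e : G ⊗ P ⟶ G, IsFactorProjection x p e := by
  obtain ⟨e, he⟩ := ha.exists_hom hΛ (hx.prod hp) (fun c mi => (ρ c mi.1, s c mi.2))
    (fun c mi => by simp [comp_lift, hρ, hs]) (fun c mi => by simp [hρρ])
    (fun mi => x (Pi.mulSingle mi.2 (mi.1 mi.2))) (fun c mi => by rw [hρ, hρs])
  exact ⟨e, hΛ, hx, hp, fun m i => he (m, i)⟩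

/-- Over `P ⊗ Λ`, the constant group `H` is the image of the factor projection `e`. -/
theorem IsFactorProjection.exists_splitting {N : Type*} [Group N] {t : ℕ}
    {x : (Fin t → N) →* (Λ ⟶ G)} {p : Fin t → (Λ ⟶ P)} {e : G ⊗ P ⟶ G}
    (he : IsFactorProjection x p e) {y : N →* (Λ ⟶ H)} (hy : IsSplit Λ H y) :
    ∃ (j : H ⊗ (P ⊗ Λ) ⟶ G) (q : G ⊗ (P ⊗ Λ) ⟶ H), IsMultiplicative j ∧ IsMultiplicative q ∧
      lift j (snd _ _) ≫ q = fst _ _ ∧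
      lift q (snd _ _) ≫ j = lift (fst _ _) (snd _ _ ≫ fst _ _) ≫ e := by
  -- At the point `i` of `P`, `j` is the inclusion of the `i`-th factor and `q` the projection onto
  -- it.
  obtain ⟨j, hj, -⟩ := hy.existsUnique_prod he.split' fun n i => x (Pi.mulSingle i n)
  obtain ⟨q, hq, -⟩ := he.split.existsUnique_prod he.split' fun m i => y (m i)
  refine ⟨j, q, .of_points_prod hy he.split' j fun m n i => ?_,
    .of_points_prod he.split he.split' q fun m n i => ?_,
    hy.hom_ext_prod he.split' fun n i => ?_, he.split.hom_ext_prod he.split' fun m i => ?_⟩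
  · rw [hj, hj, hj, ← map_mul, Pi.mulSingle_mul]
  · rw [hq, hq, hq, ← map_mul, Pi.mul_apply]
  · rw [comp_lift_assoc, hj, lift_snd, hq, lift_fst, Pi.mulSingle_eq_same]
  · rw [comp_lift_assoc, hq, lift_snd, hj, comp_lift_assoc, lift_fst, lift_snd_assoc, lift_fst,
      he.comp]

end SplitGroups

/-! ### Base change of groups via functors of points -/

section PullbackGroups

open MonoidalCategory CartesianMonoidalCategory MonObj

universe v w v' w'

variable {C : Type w} [Category.{v} C] [CartesianMonoidalCategory C]
  {D : Type w'} [Category.{v'} D] [CartesianMonoidalCategory D]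

/-- A group object `Z` that represents the group functor `U ↦ Hom(F U, X)`. -/
structure PullbackGroup (F : D ⥤ C) (X : Grp C) (Z : Grp D) where
  /-- The bijections on points. -/
  equiv : ∀ U : D, (U ⟶ Z.X) ≃* (F.obj U ⟶ X.X)
  naturality : ∀ {U V : D} (f : U ⟶ V) (z : V ⟶ Z.X), equiv U (f ≫ z) = F.map f ≫ equiv V z

namespace PullbackGroup

variable {F : D ⥤ C} {B : C} {str : ∀ U : D, F.obj U ⟶ B}
  (hstr : ∀ {U V : D} (f : U ⟶ V), F.map f ≫ str V = str U)
  {X Y : Grp C} {Z W : Grp D} (a : PullbackGroup F X Z) (b : PullbackGroup F Y W)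

theorem symm_naturality {U V : D} (f : U ⟶ V) (x : F.obj V ⟶ X.X) :
    (a.equiv U).symm (F.map f ≫ x) = f ≫ (a.equiv V).symm x := by
  rw [MulEquiv.symm_apply_eq, a.naturality, MulEquiv.apply_symm_apply]

include hstr in
-- A family of homomorphisms parametrized by the base `B` is one homomorphism between the base
-- changes to `B`. By Yoneda, it is obtained by applying `φ` to the universal point `𝟙 Z.X` and its
-- structure map.
theorem exists_hom {φ : X.X ⊗ B ⟶ Y.X} (hφ : IsMultiplicative φ) :
    ∃ g : Z ⟶ W, ∀ (U : D) (z : U ⟶ Z.X),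
      b.equiv U (z ≫ g.hom.hom) = lift (a.equiv U z) (str U) ≫ φ := by
  let g : Z.X ⟶ W.X := (b.equiv _).symm (lift (a.equiv _ (𝟙 Z.X)) (str Z.X) ≫ φ)
  have hg (U : D) (z : U ⟶ Z.X) : b.equiv U (z ≫ g) = lift (a.equiv U z) (str U) ≫ φ := by
    rw [b.naturality, MulEquiv.apply_symm_apply, comp_lift_assoc, hstr, ← a.naturality,
      Category.comp_id]
  have hmul (U : D) (z z' : U ⟶ Z.X) : (z * z') ≫ g = z ≫ g * z' ≫ g := by
    apply (b.equiv U).injective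
    rw [hg, map_mul, map_mul, hg, hg, hφ]
  have hone (U : D) : (1 : U ⟶ Z.X) ≫ g = 1 := by
    have := hmul U 1 1
    rwa [_root_.one_mul, left_eq_mul] at this
  refine ⟨Grp.homMk'' g (by rw [one_eq_one, hone, one_eq_one]) ?_, hg⟩
  rw [mul_eq_mul, hmul, mul_eq_mul, comp_mul]
  simp

include a in
theorem hom_ext {g g' : W ⟶ Z} (h : ∀ (U : D) (z : U ⟶ W.X),
    a.equiv U (z ≫ g.hom.hom) = a.equiv U (z ≫ g'.hom.hom)) : g = g' := by
  apply Grp.hom_ext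
  simpa using h _ (𝟙 _)

end PullbackGroup

end PullbackGroups

/-! ### Functors of points of base-changed group schemes -/

section BaseChange

open MonoidalCategory CartesianMonoidalCategory MonObj Limits

open scoped Obj in
/-- The base change of a group scheme represents the restriction of its functor of points. -/
noncomputable def groupBaseChangePullbackGroup {S T : Scheme.{u}} (p : T ⟶ S) (G : Grp (Over S)) :
    PullbackGroup (Over.map p) G (groupBaseChange p G) where
  equiv U := MulEquiv.symm
    { toEquiv := (Over.mapPullbackAdj p).homEquiv U G.X
      map_mul' := fun x y => by
        simp only [Equiv.toFun_as_coe, Adjunction.homEquiv_unit]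
        rw [Functor.map_mul, comp_mul]
        rfl }
  naturality f z := (Over.mapPullbackAdj p).homEquiv_naturality_left_symm f z

theorem groupBaseChangePullbackGroup_left {S T : Scheme.{u}} (p : T ⟶ S) (G : Grp (Over S))
    (U : Over T) (z : U ⟶ (groupBaseChange p G).X) :
    ((groupBaseChangePullbackGroup p G).equiv U z).left = z.left ≫ pullback.fst G.X.hom p := rfl

/-- The pullback of group objects is transitive. -/
def PullbackGroup.comp {C D E : Type*} [Category* C] [Category* D] [Category* E]
    [CartesianMonoidalCategory C] [CartesianMonoidalCategory D] [CartesianMonoidalCategory E]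
    {F : D ⥤ C} {F' : E ⥤ D} {X : Grp C} {Z : Grp D} {W : Grp E} (a : PullbackGroup F X Z)
    (b : PullbackGroup F' Z W) : PullbackGroup (F' ⋙ F) X W where
  equiv U := (b.equiv U).trans (a.equiv _)
  naturality f z := by simp [b.naturality, a.naturality]

end BaseChange

/-! ### The image of the idempotent: Weil restriction and form -/

section WeilRestriction

open MonoidalCategory CartesianMonoidalCategory MonObj Limits

/-- The base change of a homomorphism of group schemes. -/
noncomputable def groupBaseChangeMap {S T : Scheme.{u}} (p : T ⟶ S) {G H : Grp (Over S)}
    (E : G ⟶ H) : groupBaseChange p G ⟶ groupBaseChange p H :=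
  (Over.pullback p).mapGrp.map E

theorem groupBaseChangeMap_id {S T : Scheme.{u}} (p : T ⟶ S) (G : Grp (Over S)) :
    groupBaseChangeMap p (𝟙 G) = 𝟙 _ :=
  (Over.pullback p).mapGrp.map_id G

theorem groupBaseChangeMap_comp {S T : Scheme.{u}} (p : T ⟶ S) {G H K : Grp (Over S)}
    (E : G ⟶ H) (E' : H ⟶ K) :
    groupBaseChangeMap p (E ≫ E') = groupBaseChangeMap p E ≫ groupBaseChangeMap p E' :=
  (Over.pullback p).mapGrp.map_comp E E'

theorem groupBaseChangePullbackGroup_comp_map {S T : Scheme.{u}} (p : T ⟶ S)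
    {G H : Grp (Over S)} (E : G ⟶ H) (U : Over T) (z : U ⟶ (groupBaseChange p G).X) :
    (groupBaseChangePullbackGroup p H).equiv U (z ≫ (groupBaseChangeMap p E).hom.hom) =
      (groupBaseChangePullbackGroup p G).equiv U z ≫ E.hom.hom :=
  (Over.mapPullbackAdj p).homEquiv_naturality_right_symm z E.hom.hom

open scoped Obj in
/-- The base change of points of a group scheme. -/
noncomputable def pointBaseChange {S T : Scheme.{u}} (p : T ⟶ S) (G : Grp (Over S)) (U : Over S) :
    (U ⟶ G.X) →* ((Over.pullback p).obj U ⟶ (groupBaseChange p G).X) where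
  toFun g := (Over.pullback p).map g
  map_one' := Functor.map_one _
  map_mul' := Functor.map_mul _

theorem pointBaseChange_comp {S T : Scheme.{u}} (p : T ⟶ S) (G : Grp (Over S)) {U V : Over S}
    (h : U ⟶ V) (g : V ⟶ G.X) :
    pointBaseChange p G U (h ≫ g) = (Over.pullback p).map h ≫ pointBaseChange p G V g :=
  (Over.pullback p).map_comp h g

theorem equiv_pointBaseChange_left {S T : Scheme.{u}} (p : T ⟶ S) (G : Grp (Over S)) (U : Over S)
    (g : U ⟶ G.X) :
    ((groupBaseChangePullbackGroup p G).equiv _ (pointBaseChange p G U g)).left =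
      pullback.fst U.hom p ≫ g.left := by
  rw [groupBaseChangePullbackGroup_left]
  exact pullback.lift_fst _ _ _

/-- A scheme over `S'`, seen as a scheme over `S`, lies over `S'`. -/
def mapStr {S S' : Scheme.{u}} (f : S' ⟶ S) (U : Over S') : (Over.map f).obj U ⟶ Over.mk f :=
  Over.homMk U.hom rfl

/-- The image of an idempotent is its equalizer with the identity, which exists for group schemes.
-/
instance {S : Scheme.{u}} : IsIdempotentComplete (Grp (Over S)) :=
  Idempotents.isIdempotentComplete_iff_hasEqualizer_of_id_and_idempotent _ |>.2
    fun _ _ _ => inferInstance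

variable {S S' : Scheme.{u}} {f : S' ⟶ S} {Λ : Over S} {G H : Grp (Over S)} {N : Type*} [Group N]
  {t : ℕ} {x : (Fin t → N) →* (Λ ⟶ G.X)} {p : Fin t → (Λ ⟶ Over.mk f)} {e : G.X ⊗ Over.mk f ⟶ G.X}

open scoped Obj in
-- Points of the image `N'` over `T ×_S S'` are the `S'`-families of points of `G` fixed by `e`, and
-- `IsFactorProjection.existsUnique` matches these with the points of `G` over `T`.
theorem IsFactorProjection.isWeilRestriction (he : IsFactorProjection x p e)
    {E : groupBaseChange f G ⟶ groupBaseChange f G}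
    (hE : ∀ (U : Over S') (z : U ⟶ (groupBaseChange f G).X),
      (groupBaseChangePullbackGroup f G).equiv U (z ≫ E.hom.hom) =
        lift ((groupBaseChangePullbackGroup f G).equiv U z) (mapStr f U) ≫ e)
    {N' : Grp (Over S')} (i : N' ⟶ groupBaseChange f G) (r : groupBaseChange f G ⟶ N')
    (hir : i ≫ r = 𝟙 N') (hri : r ≫ i = E) : IsWeilRestriction f N' G := by
  let a := groupBaseChangePullbackGroup f G
  let m (T : Over S) : (T ⟶ G.X) →* ((Over.pullback f).obj T ⟶ N'.X) :=
    (IsMonHom.monoidHom r.hom.hom _).comp (pointBaseChange f G T)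
  have hmdef (T : Over S) (g : T ⟶ G.X) : m T g = pointBaseChange f G T g ≫ r.hom.hom := rfl
  have hm (T : Over S) : Function.Bijective (m T) := by
    rw [Function.bijective_iff_existsUnique]
    intro y
    -- Both objects are the scheme `T ×_S S'`; only their structure maps to `S` are written
    -- differently.
    let κ : T ⊗ Over.mk f ⟶ (Over.map f).obj ((Over.pullback f).obj T) :=
      Over.homMk (𝟙 _) (by
        simpa using (pullback.condition (f := T.hom) (g := f)).symm)
    have hκ : IsIso κ := by
      have : IsIso ((Over.forget S).map κ) := inferInstanceAs (IsIso (𝟙 _))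
      exact isIso_of_reflects_iso κ (Over.forget S)
    have hκs : κ ≫ mapStr f ((Over.pullback f).obj T) = snd T (Over.mk f) := by
      ext1
      exact Category.id_comp _
    have hκf (g : T ⟶ G.X) : κ ≫ a.equiv _ (pointBaseChange f G T g) = fst T (Over.mk f) ≫ g := by
      ext1
      rw [Over.comp_left, equiv_pointBaseChange_left]
      exact Category.id_comp _
    have hiff (g : T ⟶ G.X) : m T g = y ↔ lift (fst T (Over.mk f) ≫ g) (snd T (Over.mk f)) ≫ e =
        κ ≫ a.equiv _ (y ≫ i.hom.hom) := by
      have h1 : lift (fst T (Over.mk f) ≫ g) (snd T (Over.mk f)) ≫ e =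
          κ ≫ a.equiv _ (pointBaseChange f G T g ≫ E.hom.hom) := by
        rw [hE, comp_lift_assoc, hκs, hκf]
      rw [h1, cancel_epi, (a.equiv _).injective.eq_iff]
      constructor
      · rintro rfl
        rw [hmdef, Category.assoc, ← hri]
        rfl
      · intro h
        have := congrArg (· ≫ r.hom.hom) h
        have hir' : i.hom.hom ≫ r.hom.hom = 𝟙 _ := congrArg (fun g => g.hom.hom) hir
        rw [← hri] at this
        change (_ ≫ r.hom.hom ≫ i.hom.hom) ≫ r.hom.hom = (y ≫ i.hom.hom) ≫ r.hom.hom at this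
        rw [Category.assoc, Category.assoc, Category.assoc, hir', Category.comp_id,
          Category.comp_id] at this
        exact this
    simp only [hiff]
    refine he.existsUnique _ ?_
    have h2 : y ≫ i.hom.hom = (y ≫ i.hom.hom) ≫ E.hom.hom := by
      have : i ≫ E = i := by rw [← hri, reassoc_of% hir]
      rw [Category.assoc]
      exact congrArg (fun g => y ≫ g.hom.hom) this.symm
    conv_rhs => rw [h2, hE]
    rw [comp_lift_assoc, hκs]
  refine ⟨NatIso.ofComponents (fun T => (MulEquiv.ofBijective (m T.unop) (hm T.unop)).toGrpIso)
    fun {T U} g => ?_⟩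
  ext z
  change m _ (g.unop ≫ (show T.unop ⟶ G.X from z)) =
    (Over.pullback f).map g.unop ≫ m _ (show T.unop ⟶ G.X from z)
  rw [hmdef, hmdef, pointBaseChange_comp, Category.assoc]

/-- After base change to `S' ×_S Λ`, both `N'` and the constant group split the same idempotent, and
two splittings of an idempotent are isomorphic. -/
theorem IsFactorProjection.isForm [Etale Λ.hom] [Surjective Λ.hom]
    (he : IsFactorProjection x p e) {y : N →* (Λ ⟶ H.X)} (hy : IsSplit Λ H.X y)
    {E : groupBaseChange f G ⟶ groupBaseChange f G}
    (hE : ∀ (U : Over S') (z : U ⟶ (groupBaseChange f G).X),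
      (groupBaseChangePullbackGroup f G).equiv U (z ≫ E.hom.hom) =
        lift ((groupBaseChangePullbackGroup f G).equiv U z) (mapStr f U) ≫ e)
    {N' : Grp (Over S')} (i : N' ⟶ groupBaseChange f G) (r : groupBaseChange f G ⟶ N')
    (hir : i ≫ r = 𝟙 N') (hri : r ≫ i = E) : IsForm N' (groupBaseChange f H) := by
  obtain ⟨j, q, hj, hq, hjq, hqj⟩ := he.exists_splitting hy
  let π : (Over.mk f ⊗ Λ).left ⟶ S' := (fst (Over.mk f) Λ).left
  let a := (groupBaseChangePullbackGroup f G).comp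
    (groupBaseChangePullbackGroup π (groupBaseChange f G))
  let b := (groupBaseChangePullbackGroup f H).comp
    (groupBaseChangePullbackGroup π (groupBaseChange f H))
  let str (U : Over (Over.mk f ⊗ Λ).left) : (Over.map π ⋙ Over.map f).obj U ⟶ Over.mk f ⊗ Λ :=
    Over.homMk U.hom rfl
  have hstr {U V : Over (Over.mk f ⊗ Λ).left} (g : U ⟶ V) :
      (Over.map π ⋙ Over.map f).map g ≫ str V = str U := by
    apply Over.OverMorphism.ext
    exact Over.w g
  obtain ⟨J, hJ⟩ := b.exists_hom hstr a hj
  obtain ⟨Q, hQ⟩ := a.exists_hom hstr b hq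
  have hJQ : J ≫ Q = 𝟙 _ := by
    refine b.hom_ext fun U z => ?_
    have h1 : z ≫ (J ≫ Q).hom.hom = (z ≫ J.hom.hom) ≫ Q.hom.hom := by simp
    have h2 := congrArg (fun g => lift (b.equiv U z) (str U) ≫ g) hjq
    simp only [comp_lift_assoc, lift_snd, lift_fst] at h2
    rw [h1, hQ, hJ, h2]
    simp
  have hQJ : Q ≫ J = groupBaseChangeMap π E := by
    refine a.hom_ext fun U z => ?_
    have h1 : z ≫ (Q ≫ J).hom.hom = (z ≫ Q.hom.hom) ≫ J.hom.hom := by simp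
    have h2 := congrArg (fun g => lift (a.equiv U z) (str U) ≫ g) hqj
    simp only [comp_lift_assoc, lift_snd, lift_fst, lift_snd_assoc] at h2
    rw [h1, hJ, hQ, h2]
    refine Eq.trans ?_ (congrArg ((groupBaseChangePullbackGroup f G).equiv _)
      (groupBaseChangePullbackGroup_comp_map π E U z)).symm
    rw [hE]
    congr 2
  let i' := groupBaseChangeMap π i
  let r' := groupBaseChangeMap π r
  have hir' : i' ≫ r' = 𝟙 _ := by
    rw [← groupBaseChangeMap_comp, hir, groupBaseChangeMap_id]
  have hri' : r' ≫ i' = Q ≫ J := by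
    rw [← groupBaseChangeMap_comp, hri, hQJ]
  refine ⟨_, π, ?_, ?_, ⟨⟨i' ≫ Q, J ≫ r', ?_, ?_⟩⟩⟩
  · exact inferInstanceAs (Etale (pullback.fst f Λ.hom))
  · exact inferInstanceAs (Surjective (pullback.fst f Λ.hom))
  · rw [Category.assoc, ← Category.assoc Q, ← hri', Category.assoc, hir', Category.comp_id, hir']
  · rw [Category.assoc, ← Category.assoc r', hri', Category.assoc, hJQ, Category.comp_id, hJQ]

theorem IsFactorProjection.exists_weilRestriction [Etale Λ.hom] [Surjective Λ.hom]
    (he : IsFactorProjection x p e) {y : N →* (Λ ⟶ H.X)} (hy : IsSplit Λ H.X y) :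
    ∃ N' : Grp (Over S'), IsForm N' (groupBaseChange f H) ∧ IsWeilRestriction f N' G := by
  let a := groupBaseChangePullbackGroup f G
  obtain ⟨E, hE⟩ := a.exists_hom (B := Over.mk f)
    (str := mapStr f) (fun g => Over.OverMorphism.ext (Over.w g)) a he.isMultiplicative
  have hEE : E ≫ E = E := a.hom_ext fun U z => by
    have h1 : z ≫ (E ≫ E).hom.hom = (z ≫ E.hom.hom) ≫ E.hom.hom := by simp
    rw [h1, hE, hE, he.idem]
  obtain ⟨N', i, r, hir, hri⟩ := IsIdempotentComplete.idempotents_split _ E hEE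
  exact ⟨N', he.isForm hy hE i r hir hri, he.isWeilRestriction hE i r hir hri⟩

end WeilRestriction

/-! ### Descent and disjoint unions of schemes -/

section SplitSchemes

open MonoidalCategory CartesianMonoidalCategory Limits

variable {S : Scheme.{u}} {Λ X : Over S}

/-- Morphisms of schemes descend along flat, surjective and quasi-compact morphisms. -/
theorem descends_of_flat [Flat Λ.hom] [Surjective Λ.hom] [QuasiCompact Λ.hom] : Descends Λ := by
  intro T Y h hh
  let q : (T ⊗ Λ).left ⟶ T.left := (fst T Λ).left
  have h1 : Flat q := inferInstanceAs (Flat (pullback.fst T.hom Λ.hom))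
  have h2 : Surjective q := inferInstanceAs (Surjective (pullback.fst T.hom Λ.hom))
  have h3 : QuasiCompact q := inferInstanceAs (QuasiCompact (pullback.fst T.hom Λ.hom))
  have hq : q ≫ T.hom = (T ⊗ Λ).hom := Over.w (fst T Λ)
  -- Two morphisms that agree after `q` factor jointly through `T ⊗ (Λ ⊗ Λ)`, where `hh` applies.
  have key {Z : Scheme.{u}} (g₁ g₂ : Z ⟶ (T ⊗ Λ).left) (hg : g₁ ≫ q = g₂ ≫ q) :
      g₁ ≫ h.left = g₂ ≫ h.left := by
    let Z' : Over S := Over.mk (g₁ ≫ (T ⊗ Λ).hom)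
    let G₁ : Z' ⟶ T ⊗ Λ := Over.homMk g₁ rfl
    let G₂ : Z' ⟶ T ⊗ Λ := Over.homMk g₂ (by
      change g₂ ≫ (T ⊗ Λ).hom = g₁ ≫ (T ⊗ Λ).hom
      rw [← hq, reassoc_of% hg])
    have hG : G₁ ≫ fst T Λ = G₂ ≫ fst T Λ := Over.OverMorphism.ext hg
    have e₁ : lift (G₁ ≫ fst T Λ) (lift (G₁ ≫ snd T Λ) (G₂ ≫ snd T Λ)) ≫ T ◁ fst Λ Λ = G₁ := by
      ext1 <;> simp
    have e₂ : lift (G₁ ≫ fst T Λ) (lift (G₁ ≫ snd T Λ) (G₂ ≫ snd T Λ)) ≫ T ◁ snd Λ Λ = G₂ := by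
      ext1 <;> simp [hG]
    have : G₁ ≫ h = G₂ ≫ h := by
      conv_lhs => rw [← e₁, Category.assoc, hh, ← Category.assoc, e₂]
    exact congrArg (fun g => g.left) this
  let g : T.left ⟶ Y.left := EffectiveEpi.desc q h.left key
  have hg : q ≫ g = h.left := EffectiveEpi.fac q h.left key
  refine ⟨Over.homMk g ?_, Over.OverMorphism.ext hg, fun g' hg' => Over.OverMorphism.ext ?_⟩
  · rw [← cancel_epi q, reassoc_of% hg, hq]
    exact Over.w h
  · change g'.left = g
    rw [← cancel_epi q, hg]
    exact congrArg (fun g => g.left) hg'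

theorem isPullback_whiskerLeft_left (X : Over S) {T : Over S} (τ : T ⟶ Λ) :
    IsPullback (X ◁ τ).left (snd X T).left (snd X Λ).left τ.left := by
  refine IsPullback.of_right (t := IsPullback.of_hasPullback X.hom Λ.hom) ?_ ?_
  · have h : (X ◁ τ).left ≫ pullback.fst X.hom Λ.hom = pullback.fst X.hom T.hom :=
      congrArg (fun g => g.left) (whiskerLeft_fst X τ)
    rw [h, Over.w]
    exact IsPullback.of_hasPullback X.hom T.hom
  · exact congrArg (fun g => g.left) (whiskerLeft_snd X τ)

/-- Finite coproducts of schemes are stable under base change, so the decomposition over `Λ` itself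
pulls back along every `τ : T ⟶ Λ`. -/
theorem isSplit_of_isColimit {J : Type*} [Finite J] {x : J → (Λ ⟶ X)}
    (hx : IsColimit (Cofan.mk (X ⊗ Λ).left fun j => (lift (x j) (𝟙 Λ)).left)) :
    IsSplit Λ X x := by
  intro T Y τ y
  have hc : Nonempty (IsColimit (Cofan.mk (X ⊗ T).left fun j => (lift (τ ≫ x j) (𝟙 T)).left)) := by
    refine FinitaryPreExtensive.isUniversal_finiteCoproducts hx _
      (Discrete.natTrans fun _ => τ.left) (X ◁ τ).left ?_ (.of_discrete _) fun ⟨j⟩ => ?_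
    · ext ⟨j⟩
      change τ.left ≫ (lift (x j) (𝟙 Λ)).left = (lift (τ ≫ x j) (𝟙 T)).left ≫ (X ◁ τ).left
      rw [← Over.comp_left, ← Over.comp_left]
      congr 1
      ext1 <;> simp
    · change IsPullback (lift (τ ≫ x j) (𝟙 T)).left τ.left (X ◁ τ).left (lift (x j) (𝟙 Λ)).left
      refine IsPullback.of_right ?_ ?_ (isPullback_whiskerLeft_left X τ).flip
      · rw [← Over.comp_left, ← Over.comp_left, lift_snd, lift_snd, Over.id_left, Over.id_left]
        exact IsPullback.of_horiz_isIso ⟨by simp⟩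
      · rw [← Over.comp_left, ← Over.comp_left]
        congr 1
        ext1 <;> simp
  obtain ⟨hc⟩ := hc
  have hinj (j : J) (h : X ⊗ T ⟶ Y) : (lift (τ ≫ x j) (𝟙 T) ≫ h).left =
    (Cofan.mk (X ⊗ T).left fun j => (lift (τ ≫ x j) (𝟙 T)).left).inj j ≫ h.left := rfl
  let g : (X ⊗ T).left ⟶ Y.left := Cofan.IsColimit.desc hc fun j => (y j).left
  have hg (j) : (lift (τ ≫ x j) (𝟙 T)).left ≫ g = (y j).left :=
    Cofan.IsColimit.fac hc (fun j => (y j).left) j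
  refine ⟨Over.homMk g ?_, fun j => Over.OverMorphism.ext (hg j),
    fun g' hg' => Over.OverMorphism.ext ?_⟩
  · refine Cofan.IsColimit.hom_ext hc _ _ fun j => ?_
    change (lift (τ ≫ x j) (𝟙 T)).left ≫ g ≫ Y.hom = (lift (τ ≫ x j) (𝟙 T)).left ≫ (X ⊗ T).hom
    rw [reassoc_of% hg j, Over.w, Over.w]
  · refine Cofan.IsColimit.hom_ext hc _ _ fun j => ?_
    change (lift (τ ≫ x j) (𝟙 T)).left ≫ g'.left = (lift (τ ≫ x j) (𝟙 T)).left ≫ g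
    rw [hg, ← hg' j]
    rfl

end SplitSchemes

/-! ### Spectra of algebras split by `L` -/

section AffineSplit

open MonoidalCategory CartesianMonoidalCategory Limits

variable {k : Type u} [CommRing k]

/-- The spectrum of a `k`-algebra as a scheme over `Spec k`. -/
noncomputable abbrev specOver (k R : Type u) [CommRing k] [CommRing R] [Algebra k R] :
    Over (Spec (.of k)) :=
  Over.mk (Spec.map (CommRingCat.ofHom (algebraMap k R)))

variable {R R' R'' L : Type u} [CommRing R] [Algebra k R] [CommRing R'] [Algebra k R']
  [CommRing R''] [Algebra k R''] [CommRing L] [Algebra k L]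

/-- The morphism of spectra given by a homomorphism of `k`-algebras. -/
noncomputable def specOverMap (φ : R →ₐ[k] R') : specOver k R' ⟶ specOver k R :=
  Over.homMk (Spec.map (CommRingCat.ofHom φ.toRingHom)) (by
    change Spec.map _ ≫ Spec.map _ = Spec.map _
    rw [← Spec.map_comp, ← CommRingCat.ofHom_comp, AlgHom.toRingHom_eq_coe, AlgHom.comp_algebraMap])

theorem specOverMap_comp (φ : R →ₐ[k] R') (ψ : R' →ₐ[k] R'') :
    specOverMap ψ ≫ specOverMap φ = specOverMap (ψ.comp φ) := by
  apply Over.OverMorphism.ext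
  change Spec.map _ ≫ Spec.map _ = Spec.map _
  rw [← Spec.map_comp, ← CommRingCat.ofHom_comp]
  rfl

theorem specOverMap_id : specOverMap (AlgHom.id k R) = 𝟙 _ := by
  apply Over.OverMorphism.ext
  exact Spec.map_id _

theorem specOverMap_injective :
    Function.Injective (specOverMap : (R →ₐ[k] R') → (specOver k R' ⟶ specOver k R)) := by
  intro φ ψ h
  have h' := Spec.map_injective (congrArg (fun g => g.left) h)
  exact AlgHom.ext fun r => congrArg (fun g => g.hom r) h'

theorem exists_specOverMap_eq (f : specOver k R' ⟶ specOver k R) :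
    ∃ φ : R →ₐ[k] R', specOverMap φ = f := by
  obtain ⟨g, hg⟩ := Spec.map_surjective f.left
  have hw := Over.w f
  change f.left ≫ Spec.map _ = Spec.map _ at hw
  rw [← hg, ← Spec.map_comp] at hw
  have hw' := Spec.map_injective hw
  refine ⟨{ g.hom with commutes' := fun r => ?_ }, ?_⟩
  · exact congrArg (fun h => h.hom r) hw'
  · apply Over.OverMorphism.ext
    rw [← hg]
    rfl

/-- The spectrum of a `k`-algebra `R` is split over `Spec L` if the homomorphisms `φ j : R → L`
induce an isomorphism `R ⊗ L ≃ L ^ J`. -/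
theorem isSplit_specOver {J : Type u} [Finite J] (φ : J → (R →ₐ[k] L))
    (hφ : Function.Bijective (AlgHom.pi
      fun j => Algebra.TensorProduct.productMap (φ j) (AlgHom.id k L))) :
    IsSplit (specOver k L) (specOver k R) fun j => specOverMap (φ j) := by
  set ψ : R ⊗[k] L →ₐ[k] (J → L) := AlgHom.pi
      fun j => Algebra.TensorProduct.productMap (φ j) (AlgHom.id k L) with hψ
  let e : (R ⊗[k] L) ≃+* (J → L) := RingEquiv.ofBijective ψ hφ
  have he : IsIso (Spec.map (CommRingCat.ofHom ψ.toRingHom)) :=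
    inferInstanceAs (IsIso (Scheme.Spec.map e.toCommRingCatIso.hom.op))
  let c : Cofan (fun _ : J => Spec (.of L)) := Cofan.mk (Spec (.of (J → L))) fun j =>
    Spec.map (CommRingCat.ofHom (Pi.evalRingHom (fun _ : J => L) j))
  -- The spectrum of a finite product of rings is the coproduct of the spectra.
  have hc : Nonempty (IsColimit c) :=
    c.nonempty_isColimit_iff_isIso_sigmaDesc.mpr
      (inferInstanceAs (IsIso (sigmaSpec fun _ : J => CommRingCat.of L)))
  obtain ⟨hc⟩ := hc
  let i : Spec (.of (J → L)) ≅ (specOver k R ⊗ specOver k L).left :=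
    asIso (Spec.map (CommRingCat.ofHom ψ.toRingHom)) ≪≫ (pullbackSpecIso k R L).symm
  refine isSplit_of_isColimit (IsColimit.ofIsoColimit hc (Cofan.ext i fun j => ?_))
  refine pullback.hom_ext ?_ ?_
  · change (Spec.map _ ≫ Spec.map _ ≫ (pullbackSpecIso k R L).inv) ≫ pullback.fst _ _ =
      (lift (specOverMap (φ j)) (𝟙 (specOver k L)) ≫ fst _ _).left
    rw [lift_fst, Category.assoc, Category.assoc, pullbackSpecIso_inv_fst, ← Spec.map_comp,
      ← Spec.map_comp]
    refine congrArg Spec.map (CommRingCat.hom_ext (RingHom.ext fun r => ?_))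
    change ψ (r ⊗ₜ 1) j = φ j r
    simp [hψ]
  · change (Spec.map _ ≫ Spec.map _ ≫ (pullbackSpecIso k R L).inv) ≫ pullback.snd _ _ =
      (lift (specOverMap (φ j)) (𝟙 (specOver k L)) ≫ snd _ _).left
    rw [lift_snd, Category.assoc, Category.assoc, pullbackSpecIso_inv_snd, ← Spec.map_comp,
      ← Spec.map_comp, Over.id_left]
    refine Eq.trans (congrArg Spec.map (CommRingCat.hom_ext (RingHom.ext fun r => ?_)))
      (Spec.map_id _)
    change ψ (1 ⊗ₜ r) j = r
    simp [hψ]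

theorem IsSplit.reindex {C : Type*} [Category C] [CartesianMonoidalCategory C] {Λ X : C}
    {I J : Type*} {x : J → (Λ ⟶ X)} (hx : IsSplit Λ X x) (e : I ≃ J) :
    IsSplit Λ X (x ∘ e) := by
  intro T Y τ y
  obtain ⟨h, h1, h2⟩ := hx τ (y ∘ e.symm)
  refine ⟨h, fun i => by simpa using h1 (e i), fun h' hh => h2 h' fun j => ?_⟩
  simpa using hh (e.symm j)

end AffineSplit

/-! ### The étale algebra of a finite Galois set -/

section GaloisDescent

variable (k L : Type*) [Field k] [Field L] [Algebra k L] [FiniteDimensional k L] [IsGalois k L]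

open Classical in
/-- A basis of a finite Galois extension for which the matrix of all conjugates is invertible. -/
theorem exists_basis_isUnit_conjugates :
    ∃ b : Module.Basis (L ≃ₐ[k] L) k L, IsUnit (Matrix.of fun σ i : L ≃ₐ[k] L => σ (b i)) := by
  have hcard : Fintype.card (Fin (Module.finrank k L)) = Fintype.card (L ≃ₐ[k] L) := by
    rw [Fintype.card_fin, ← IsGalois.card_aut_eq_finrank, Nat.card_eq_fintype_card]
  let b := (Module.finBasis k L).reindex (Fintype.equivOfCardEq hcard)
  refine ⟨b, Matrix.linearIndependent_rows_iff_isUnit.mp ?_⟩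
  -- Dedekind's independence of characters: a relation between the rows is a relation between the
  -- automorphisms, evaluated on a basis.
  have h := (linearIndependent_algHom_toLinearMap k L L).comp
    (fun σ : L ≃ₐ[k] L => (σ : L →ₐ[k] L)) AlgEquiv.coe_toAlgHom_injective
  rw [Fintype.linearIndependent_iff] at h ⊢
  intro g hg
  refine h g (b.ext fun i => ?_)
  simpa [Finset.sum_apply] using congrFun hg i

/-- For a finite Galois extension `L / k`, the conjugations induce `L ⊗ L ≃ L ^ Gal(L / k)`. -/
theorem bijective_pi_conjugates :
    Function.Bijective (AlgHom.pi fun σ : L ≃ₐ[k] L =>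
      Algebra.TensorProduct.productMap (σ : L →ₐ[k] L) (AlgHom.id k L)) := by
  classical
  obtain ⟨b, hb⟩ := exists_basis_isUnit_conjugates k L
  set B := Matrix.of fun σ i : L ≃ₐ[k] L => σ (b i)
  set ψ := AlgHom.pi fun σ : L ≃ₐ[k] L =>
      Algebra.TensorProduct.productMap (σ : L →ₐ[k] L) (AlgHom.id k L)
  have hψ (y : (L ≃ₐ[k] L) → L) : ψ (∑ i, b i ⊗ₜ[k] y i) = B.mulVec y := by
    funext σ
    simp [ψ, B, Matrix.mulVec, dotProduct]
  constructor
  · refine (injective_iff_map_eq_zero ψ).mpr fun z hz => ?_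
    obtain ⟨y, rfl⟩ := TensorProduct.eq_repr_basis_left b z
    rw [Finsupp.sum_fintype _ _ (by simp)] at hz ⊢
    rw [hψ] at hz
    have hy : (y : (L ≃ₐ[k] L) → L) = 0 :=
      Matrix.mulVec_injective_iff_isUnit.mpr hb (hz.trans (Matrix.mulVec_zero _).symm)
    simp [hy]
  · intro v
    obtain ⟨y, hy⟩ := Matrix.mulVec_surjective_iff_isUnit.mpr hb v
    exact ⟨_, (hψ y).trans hy⟩

variable {k L} {J : Type*}

/-- The algebra of functions `J → L` that are equivariant for an action of `Gal(L / k)` on `J`. -/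
def equivariantSubalgebra (s : (L ≃ₐ[k] L) →* Equiv.Perm J) : Subalgebra k (J → L) where
  carrier := {a | ∀ σ j, a (s σ j) = σ (a j)}
  mul_mem' ha hb σ j := by simp [ha σ j, hb σ j]
  add_mem' ha hb σ j := by simp [ha σ j, hb σ j]
  algebraMap_mem' r σ j := by simp

variable (s : (L ≃ₐ[k] L) →* Equiv.Perm J)

/-- The evaluation of equivariant functions at a point. -/
def equivariantSubalgebra.eval (j : J) : equivariantSubalgebra s →ₐ[k] L :=
  (Pi.evalAlgHom k (fun _ : J => L) j).comp (equivariantSubalgebra s).val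

omit [FiniteDimensional k L] [IsGalois k L] in
theorem equivariantSubalgebra.eval_perm (σ : L ≃ₐ[k] L) (j : J) :
    eval s (s σ j) = (σ : L →ₐ[k] L).comp (eval s j) :=
  AlgHom.ext fun a => a.2 σ j

/-- Galois descent for the algebra of equivariant functions. -/
theorem equivariantSubalgebra.bijective_pi_eval :
    Function.Bijective (AlgHom.pi fun j : J =>
      Algebra.TensorProduct.productMap (eval s j) (AlgHom.id k L)) := by
  classical
  obtain ⟨b, hb⟩ := exists_basis_isUnit_conjugates k L
  set B := Matrix.of fun σ i : L ≃ₐ[k] L => σ (b i) with hB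
  set ψ := AlgHom.pi fun j : J => Algebra.TensorProduct.productMap (eval s j) (AlgHom.id k L)
  have hψ (a : (L ≃ₐ[k] L) → equivariantSubalgebra s) (y : (L ≃ₐ[k] L) → L) (j : J) :
      ψ (∑ i, a i ⊗ₜ[k] y i) j = ∑ i, (a i).1 j * y i := by
    simp [ψ, eval]
  constructor
  · intro z z' hz
    obtain ⟨a, rfl⟩ := TensorProduct.eq_repr_basis_right b z
    obtain ⟨a', rfl⟩ := TensorProduct.eq_repr_basis_right b z'
    rw [Finsupp.sum_fintype _ _ (by simp), Finsupp.sum_fintype _ _ (by simp)] at hz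
    -- Evaluating at `(s σ)⁻¹ j` and then applying `σ` moves the conjugation from the coefficients
    -- to the basis, which yields row `σ` of the system with matrix `B`.
    have key (j : J) : B.mulVec (fun i => (a i).1 j) = B.mulVec (fun i => (a' i).1 j) := by
      funext σ
      have hj : s σ ((s σ)⁻¹ j) = j := (s σ).apply_symm_apply j
      have h1 := congrFun hz ((s σ)⁻¹ j)
      rw [hψ, hψ] at h1
      have h2 := congrArg σ h1
      rw [map_sum, map_sum] at h2
      simp only [map_mul, ← (a _).2 σ, ← (a' _).2 σ, hj] at h2
      simpa [Matrix.mulVec, dotProduct, hB, mul_comm] using h2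
    have ha : a = a' := by
      refine Finsupp.ext fun i => Subtype.ext (funext fun j => ?_)
      exact congrFun (Matrix.mulVec_injective_iff_isUnit.mpr hb (key j)) i
    rw [ha]
  · intro v
    -- With `∑ i, σ (b i) * y i` equal to `1` for `σ = 1` and `0` otherwise, the Galois averages `w
    -- i` of `b i • v` recombine to `v`: only the term of the identity survives.
    obtain ⟨y, hy⟩ := Matrix.mulVec_surjective_iff_isUnit.mpr hb (Pi.single 1 1)
    let w (i : L ≃ₐ[k] L) : equivariantSubalgebra s :=
      ⟨fun j => ∑ σ : L ≃ₐ[k] L, σ (b i) * σ (v (s σ⁻¹ j)), fun τ j => by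
        rw [map_sum]
        refine (Fintype.sum_equiv (Equiv.mulLeft τ) _ _ fun σ => ?_).symm
        simp [mul_inv_rev]⟩
    refine ⟨∑ i, w i ⊗ₜ y i, funext fun j => ?_⟩
    rw [hψ]
    have h1 (σ : L ≃ₐ[k] L) : ∑ i, σ (b i) * y i = (Pi.single 1 1 : (L ≃ₐ[k] L) → L) σ :=
      congrFun hy σ
    calc ∑ i, (w i).1 j * y i
        = ∑ i, ∑ σ : L ≃ₐ[k] L, (σ (b i) * y i) * σ (v (s σ⁻¹ j)) := by
          refine Finset.sum_congr rfl fun i _ => ?_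
          rw [Finset.sum_mul]
          exact Finset.sum_congr rfl fun σ _ => by ring
      _ = ∑ σ : L ≃ₐ[k] L, (∑ i, σ (b i) * y i) * σ (v (s σ⁻¹ j)) := by
          rw [Finset.sum_comm]
          simp only [Finset.sum_mul]
      _ = v j := by
          simp only [h1]
          rw [Finset.sum_eq_single 1 (fun σ _ hσ => by simp [hσ]) (by simp)]
          simp

/-- The algebra of equivariant functions becomes split over `L`. -/
noncomputable def equivariantSubalgebra.tensorEquiv :
    L ⊗[k] equivariantSubalgebra s ≃ₐ[L] (J → L) :=
  AlgEquiv.ofBijective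
    (AlgHom.pi fun j => Algebra.TensorProduct.lift (Algebra.ofId L L) (eval s j)
      fun _ _ => Commute.all _ _) (by
    have h := (bijective_pi_eval s).comp
      (Algebra.TensorProduct.comm k L (equivariantSubalgebra s)).bijective
    convert h using 1
    funext z
    induction z using TensorProduct.induction_on with
    | zero => simp
    | add x y hx hy => rw [map_add, hx, hy]; simp
    | tmul x y => funext j; simp [mul_comm])

/-- Étaleness descends from the split algebra `J → L` along the faithfully flat extension `L / k`.
-/
theorem equivariantSubalgebra.etale [Finite J] : Algebra.Etale k (equivariantSubalgebra s) := by
  have : Algebra.Etale L (L ⊗[k] equivariantSubalgebra s) :=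
    .of_equiv (tensorEquiv s).symm
  exact .of_etale_tensorProduct_of_faithfullyFlat L

theorem equivariantSubalgebra.finrank [Fintype J] :
    Module.finrank k (equivariantSubalgebra s) = Fintype.card J := by
  rw [← Module.finrank_baseChange (R := L), (tensorEquiv s).toLinearEquiv.finrank_eq,
    Module.finrank_fintype_fun_eq_card]

end GaloisDescent

/-! ### Points of constant group schemes -/

section ConstantGroup

open MonoidalCategory CartesianMonoidalCategory MonObj Limits

namespace FunctionAlgebra

variable (k L M : Type u) [CommRing k] [CommRing L] [Algebra k L]

/-- The evaluation at a point, with values in an algebra. -/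
noncomputable def evalIn (m : M) : FunctionAlgebra k M →ₐ[k] L :=
  (Algebra.ofId k L).comp (evalHom k M m)

theorem bijective_pi_evalIn [Finite M] : Function.Bijective (AlgHom.pi fun m : M =>
    Algebra.TensorProduct.productMap (evalIn k L M m) (AlgHom.id k L)) := by
  have h := (tensorEquiv k M L).bijective.comp
    (Algebra.TensorProduct.comm k (FunctionAlgebra k M) L).bijective
  convert h using 1
  funext z
  induction z using TensorProduct.induction_on with
  | zero => simp
  | add x y hx hy => rw [map_add, hx, hy]; simp
  | tmul x y =>
    funext m
    simp [tensorEquiv_tmul, evalIn, Algebra.ofId_apply, Algebra.smul_def]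
    rfl

/-- The indicators sum to `1`, so `φ` is nonzero on some `indicator k m`. Multiplying by that
indicator turns `f` into the scalar `f m`, and the domain `L` allows cancellation. -/
theorem exists_evalIn_eq [IsDomain L] [Finite M] (φ : FunctionAlgebra k M →ₐ[k] L) :
    ∃ m, evalIn k L M m = φ := by
  have := Fintype.ofFinite M
  have h1 : ∑ m : M, φ (indicator k m) = 1 := by
    rw [← map_sum, ← map_one φ]
    congr 1
    rw [← sum_smul_indicator 1]
    exact Finset.sum_congr rfl fun m _ => (one_smul k _).symm
  obtain ⟨m, -, hm⟩ := Finset.exists_ne_zero_of_sum_ne_zero (h1.trans_ne one_ne_zero)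
  have h2 (f : FunctionAlgebra k M) : indicator k m * f = f m • indicator k m := by
    funext x
    rw [mul_apply, smul_apply]
    by_cases hx : x = m
    · rw [hx, mul_comm]
    · rw [indicator_of_ne hx, zero_mul, mul_zero]
  refine ⟨m, AlgHom.ext fun f => ?_⟩
  have h3 := congrArg φ (h2 f)
  rw [map_mul, map_smul, Algebra.smul_def, mul_comm] at h3
  exact (mul_right_cancel₀ hm h3).symm

theorem evalIn_injective [Nontrivial L] : Function.Injective (evalIn k L M) := by
  intro m n h
  by_contra hmn
  have h1 := DFunLike.congr_fun h (indicator k m)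
  change algebraMap k L (indicator k m m) = algebraMap k L (indicator k m n) at h1
  rw [indicator_self, indicator_of_ne (Ne.symm hmn), map_one, map_zero] at h1
  exact one_ne_zero h1

end FunctionAlgebra

open FunctionAlgebra

variable (k L M : Type u) [CommRing k] [CommRing L] [Algebra k L] [Group M] [Finite M]

/-- The `L`-points of a constant group scheme given by the elements of the group. -/
noncomputable def constantGroupPoint (m : M) : specOver k L ⟶ (constantGroup k M).X :=
  specOverMap (evalIn k L M m)

theorem constantGroupPoint_mul (m n : M) :
    constantGroupPoint k L M (m * n) = constantGroupPoint k L M m * constantGroupPoint k L M n := by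
  -- The product of points of the spectrum of a Hopf algebra is the convolution product of algebra
  -- homomorphisms.
  have h : (WithConv.toConv (evalIn k L M (m * n)) : WithConv (FunctionAlgebra k M →ₐ[k] L)) =
      .toConv (evalIn k L M m) * .toConv (evalIn k L M n) := by
    have := Fintype.ofFinite M
    refine WithConv.ofConv_injective (AlgHom.ext fun f => ?_)
    have hc : Bialgebra.comulAlgHom k (FunctionAlgebra k M) f = comulHom k M f := rfl
    rw [AlgHom.convMul_def]
    change algebraMap k L (f (m * n)) = Algebra.TensorProduct.lmul' k
      (Algebra.TensorProduct.map (evalIn k L M m) (evalIn k L M n)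
        (Bialgebra.comulAlgHom k (FunctionAlgebra k M) f))
    rw [hc, comulHom_apply, map_sum, map_sum, Finset.sum_eq_single n]
    · rw [Algebra.TensorProduct.map_tmul, Algebra.TensorProduct.lmul'_apply_tmul]
      change _ = algebraMap k L (f (m * n)) * algebraMap k L (indicator k n n)
      rw [indicator_self, map_one]
      exact (MulOneClass.mul_one _).symm
    · intro p _ hp
      rw [Algebra.TensorProduct.map_tmul, Algebra.TensorProduct.lmul'_apply_tmul]
      change _ * algebraMap k L (indicator k p n) = 0
      rw [indicator_of_ne hp.symm, map_zero, mul_zero]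
    · simp
  have := congrArg Spec.mapMulEquiv h
  rw [map_mul] at this
  exact this

/-- The homomorphism from a finite group to the points of its constant group scheme. -/
noncomputable def constantGroupPoints : M →* (specOver k L ⟶ (constantGroup k M).X) :=
  MonoidHom.mk' (constantGroupPoint k L M) (constantGroupPoint_mul k L M)

theorem isSplit_constantGroup :
    IsSplit (specOver k L) (constantGroup k M).X (constantGroupPoints k L M) :=
  isSplit_specOver (evalIn k L M) (bijective_pi_evalIn k L M)

theorem constantGroupPoints_bijective [IsDomain L] :
    Function.Bijective (constantGroupPoints k L M) := by
  constructor
  · intro m n h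
    exact evalIn_injective k L M (specOverMap_injective h)
  · intro f
    obtain ⟨φ, rfl⟩ := exists_specOverMap_eq f
    obtain ⟨m, rfl⟩ := exists_evalIn_eq k L M φ
    exact ⟨m, rfl⟩

end ConstantGroup

/-! ### Points of étale covers in finite Galois extensions -/

section GaloisPoints

/-- A nonempty étale algebra over a field has a point in a finite Galois extension. -/
theorem exists_algHom_galois (k R : Type u) [Field k] [CommRing R] [Algebra k R] [Nontrivial R]
    [Algebra.Etale k R] : ∃ (L : Type u) (_ : Field L) (_ : Algebra k L),
      FiniteDimensional k L ∧ IsGalois k L ∧ Nonempty (R →ₐ[k] L) := by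
  -- `R` is a finite product of finite separable extensions `F i`. One of them is embedded into a
  -- separable closure and enlarged to its normal closure.
  obtain ⟨I, _, F, _, _, e, hF⟩ := (Algebra.Etale.iff_exists_algEquiv_prod k R).mp inferInstance
  have hI : Nonempty I := by
    by_contra h
    rw [not_nonempty_iff] at h
    exact not_subsingleton R e.toEquiv.subsingleton
  obtain ⟨i⟩ := hI
  obtain ⟨_, _⟩ := hF i
  let Ω := SeparableClosure k
  let φ : F i →ₐ[k] Ω := IsSepClosed.lift
  have : Nonempty (F i →ₐ[k] Ω) := ⟨φ⟩
  refine ⟨IntermediateField.normalClosure k (F i) Ω, inferInstance, inferInstance, inferInstance,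
    inferInstance, ⟨?_⟩⟩
  exact (((normalClosure.algHomEquiv k (F i) Ω).symm φ).comp (Pi.evalAlgHom k F i)).comp
    (e : R →ₐ[k] ∀ i, F i)

/-- A nonempty étale scheme over a field has a point in a finite Galois extension. -/
theorem exists_galois_point {k : Type u} [Field k] {T : Scheme.{u}} (p : T ⟶ Spec (.of k))
    [Etale p] [Surjective p] : ∃ (L : Type u) (_ : Field L) (_ : Algebra k L),
      FiniteDimensional k L ∧ IsGalois k L ∧
      ∃ q : Spec (.of L) ⟶ T, q ≫ p = Spec.map (CommRingCat.ofHom (algebraMap k L)) := by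
  obtain ⟨x, -⟩ := p.surjective default
  obtain ⟨R, j, _, ⟨y, -⟩, -⟩ := Scheme.exists_affine_mem_range_and_range_subset
    (x := x) (U := ⊤) trivial
  obtain ⟨g, hg⟩ := Spec.map_surjective (j ≫ p)
  have hg' : Etale (Spec.map g) := hg ▸ inferInstance
  let _ : Algebra k R := g.hom.toAlgebra
  have : Algebra.Etale k R := HasRingHomProperty.Spec_iff.mp hg'
  have : Nontrivial R := PrimeSpectrum.nontrivial y
  obtain ⟨L, _, _, h1, h2, ⟨φ⟩⟩ := exists_algHom_galois k R
  refine ⟨L, _, _, h1, h2, Spec.map (CommRingCat.ofHom φ.toRingHom) ≫ j, ?_⟩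
  rw [Category.assoc, ← hg, ← Spec.map_comp]
  exact congrArg Spec.map (CommRingCat.hom_ext φ.comp_algebraMap)

end GaloisPoints

/-! ### From an isomorphism over a cover to isomorphisms of points -/

section Forms

open MonoidalCategory CartesianMonoidalCategory MonObj Limits

variable {S T : Scheme.{u}} {p : T ⟶ S} {G H : Grp (Over S)} {Λ : Over S}

/-- Isomorphic objects have isomorphic groups of points. -/
def homMulEquivOfIso {C : Type*} [Category* C] [CartesianMonoidalCategory C] {U V : C} (w : U ≅ V)
    (G : C) [MonObj G] : (U ⟶ G) ≃* (V ⟶ G) where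
  toEquiv := w.homFromEquiv
  map_mul' _ _ := comp_mul _ _ _

/-- Isomorphic groups have isomorphic groups of points. -/
def Grp.homMulEquivOfIso {C : Type*} [Category* C] [CartesianMonoidalCategory C] {G H : Grp C}
    (i : G ≅ H) (U : C) : (U ⟶ G.X) ≃* (U ⟶ H.X) where
  toFun g := g ≫ i.hom.hom.hom
  invFun h := h ≫ i.inv.hom.hom
  left_inv g := by
    have : i.hom.hom.hom ≫ i.inv.hom.hom = 𝟙 _ := congrArg (fun g => g.hom.hom) i.hom_inv_id
    simp [this]
  right_inv h := by
    have : i.inv.hom.hom ≫ i.hom.hom.hom = 𝟙 _ := congrArg (fun g => g.hom.hom) i.inv_hom_id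
    simp [this]
  map_mul' g g' := mul_comp g g' _

/-- The object of `Over T` defined by a point of `Λ`. -/
noncomputable abbrev overOfPoint (q : Λ.left ⟶ T) {U : Over S} (τ : U ⟶ Λ) : Over T :=
  Over.mk (τ.left ≫ q)

/-- The comparison of an object with a `Λ`-point and the associated object over `T`. -/
noncomputable def overOfPointIso {q : Λ.left ⟶ T} (hq : q ≫ p = Λ.hom) {U : Over S} (τ : U ⟶ Λ) :
    U ≅ (Over.map p).obj (overOfPoint q τ) :=
  Over.isoMk (Iso.refl _) (by
    change 𝟙 _ ≫ (τ.left ≫ q) ≫ p = U.hom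
    rw [Category.id_comp, Category.assoc, hq, Over.w])

/-- The identification of the points over `T` of two groups that become isomorphic over `T`. -/
noncomputable def pointsEquivOfIso (i : groupBaseChange p G ≅ groupBaseChange p H)
    {q : Λ.left ⟶ T} (hq : q ≫ p = Λ.hom) (U : Over S) (τ : U ⟶ Λ) :
    (U ⟶ G.X) ≃* (U ⟶ H.X) :=
  (homMulEquivOfIso (overOfPointIso hq τ) G.X).trans <|
    ((groupBaseChangePullbackGroup p G).equiv (overOfPoint q τ)).symm.trans <|
    (Grp.homMulEquivOfIso i (overOfPoint q τ)).trans <|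
    ((groupBaseChangePullbackGroup p H).equiv (overOfPoint q τ)).trans
    (homMulEquivOfIso (overOfPointIso hq τ) H.X).symm

theorem pointsEquivOfIso_apply (i : groupBaseChange p G ≅ groupBaseChange p H)
    {q : Λ.left ⟶ T} (hq : q ≫ p = Λ.hom) (U : Over S) (τ : U ⟶ Λ) (g : U ⟶ G.X) :
    pointsEquivOfIso i hq U τ g = (overOfPointIso hq τ).hom ≫
      (groupBaseChangePullbackGroup p H).equiv (overOfPoint q τ)
        (((groupBaseChangePullbackGroup p G).equiv (overOfPoint q τ)).symm
          ((overOfPointIso hq τ).inv ≫ g) ≫ i.hom.hom.hom) := rfl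

theorem pointsEquivOfIso_naturality (i : groupBaseChange p G ≅ groupBaseChange p H)
    {q : Λ.left ⟶ T} (hq : q ≫ p = Λ.hom) (U V : Over S) (f : U ⟶ V) (τ : V ⟶ Λ) (g : V ⟶ G.X) :
    pointsEquivOfIso i hq U (f ≫ τ) (f ≫ g) = f ≫ pointsEquivOfIso i hq V τ g := by
  let f' : overOfPoint q (f ≫ τ) ⟶ overOfPoint q τ := Over.homMk f.left (by simp)
  have h1 : (overOfPointIso hq (f ≫ τ)).inv ≫ f =
      (Over.map p).map f' ≫ (overOfPointIso hq τ).inv := by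
    apply Over.OverMorphism.ext
    exact (Category.id_comp f.left).trans (Category.comp_id f.left).symm
  have h2 : f ≫ (overOfPointIso hq τ).hom =
      (overOfPointIso hq (f ≫ τ)).hom ≫ (Over.map p).map f' := by
    rw [← Iso.inv_comp_eq, ← Category.assoc, h1, Category.assoc, Iso.inv_hom_id, Category.comp_id]
  rw [pointsEquivOfIso_apply, pointsEquivOfIso_apply, reassoc_of% h1,
    PullbackGroup.symm_naturality, Category.assoc, PullbackGroup.naturality,
    ← reassoc_of% h2]

end Forms

/-! ### The cover `Spec L ⟶ Spec k` -/

section FieldExtension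

variable (k L : Type u) [Field k] [Field L] [Algebra k L]

theorem surjective_specOver_hom : Surjective (specOver k L).hom :=
  ⟨fun _ => ⟨(default : PrimeSpectrum L), Subsingleton.elim (α := PrimeSpectrum k) _ _⟩⟩

theorem etale_specOver_hom [FiniteDimensional k L] [Algebra.IsSeparable k L] :
    Etale (specOver k L).hom := by
  have : Algebra.Etale k L :=
    ⟨Algebra.FormallyEtale.of_isSeparable k L, Algebra.FinitePresentation.of_finiteType.mp inferInstance⟩
  refine (HasRingHomProperty.Spec_iff (P := @Etale)).mpr ?_
  exact RingHom.etale_algebraMap.mpr this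

theorem isSplit_specOver_galois [FiniteDimensional k L] [IsGalois k L] :
    IsSplit (specOver k L) (specOver k L)
      fun σ : L ≃ₐ[k] L => specOverMap (σ : L →ₐ[k] L) :=
  isSplit_specOver _ (bijective_pi_conjugates k L)

variable {k L}

theorem isSplit_equivariantSubalgebra [FiniteDimensional k L] [IsGalois k L] {t : ℕ}
    (s : (L ≃ₐ[k] L) →* Equiv.Perm (Fin t)) :
    IsSplit (specOver k L) (specOver k (equivariantSubalgebra s)) fun j =>
      specOverMap (equivariantSubalgebra.eval s j) := by
  -- The index set is lifted to the universe of the algebras and then lowered again.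
  refine (isSplit_specOver (J := ULift.{u} (Fin t))
    (fun j => equivariantSubalgebra.eval s j.down) ?_).reindex Equiv.ulift.symm
  exact (Equiv.ulift.symm.arrowCongr (Equiv.refl L)).bijective.comp
    (equivariantSubalgebra.bijective_pi_eval s)

end FieldExtension

/-! ### Assembly -/

section Main

open MonoidalCategory CartesianMonoidalCategory MonObj

/-- A form that is split by a finite Galois extension is a Weil restriction. -/
theorem exists_weilRestriction_of_isSplit {k L : Type u} [Field k] [Field L] [Algebra k L]
    [FiniteDimensional k L] [IsGalois k L] {N : Type u} [Group N] [Finite N]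
    (hindec : IsIndecomposableGroup N) (hcenter : Subgroup.center N = ⊥) {t : ℕ}
    {G : Grp (Over (Spec (.of k)))} (x : (Fin t → N) ≃* (specOver k L ⟶ G.X))
    (hx : IsSplit (specOver k L) G.X x.toMonoidHom) :
    ∃ s : (L ≃ₐ[k] L) →* Equiv.Perm (Fin t),
      ∃ N' : Grp (Over (Spec (.of (equivariantSubalgebra s)))),
        IsForm N' (groupBaseChange
          (Spec.map (CommRingCat.ofHom (algebraMap k (equivariantSubalgebra s))))
          (constantGroup k N)) ∧
        IsWeilRestriction
          (Spec.map (CommRingCat.ofHom (algebraMap k (equivariantSubalgebra s)))) N' G := by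
  have := etale_specOver_hom k L
  have := surjective_specOver_hom k L
  have : QuasiCompact (specOver k L).hom := inferInstanceAs (QuasiCompact (Spec.map _))
  have hΛ : Descends (specOver k L) := descends_of_flat
  -- `Spec` is contravariant, so precomposition with the spectra of the automorphisms is a left
  -- action on points.
  obtain ⟨ρ, s, hρ, hρρ, hρs⟩ := exists_permHom_of_points hindec hcenter
    (a := fun σ : L ≃ₐ[k] L => specOverMap (σ : L →ₐ[k] L)) specOverMap_id
    (fun c d => (specOverMap_comp (d : L →ₐ[k] L) (c : L →ₐ[k] L)).symm) x
  have hs (c : L ≃ₐ[k] L) (j) :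
      specOverMap (c : L →ₐ[k] L) ≫ specOverMap (equivariantSubalgebra.eval s j) =
        specOverMap (equivariantSubalgebra.eval s (s c j)) := by
    rw [equivariantSubalgebra.eval_perm, ← specOverMap_comp]
  obtain ⟨e, he⟩ := exists_isFactorProjection hΛ (isSplit_specOver_galois k L) hx
    (isSplit_equivariantSubalgebra s) hρ hρρ hs hρs
  exact ⟨s, he.exists_weilRestriction (isSplit_constantGroup k L N)⟩

/-- The étale cover that trivializes `G` has a point in a finite Galois extension `L`. Pulling the
isomorphism back to this point identifies `G` with the constant group over `L`, whose `L`-points are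
just `M` since `L` is a domain. -/
theorem exists_isSplit_of_isForm {k : Type u} [Field k] {M : Type u} [Group M] [Finite M]
    {G : Grp (Over (Spec (.of k)))} (hG : IsForm G (constantGroup k M)) :
    ∃ (L : Type u) (_ : Field L) (_ : Algebra k L), FiniteDimensional k L ∧ IsGalois k L ∧
      ∃ x : M ≃* (specOver k L ⟶ G.X), IsSplit (specOver k L) G.X x.toMonoidHom := by
  obtain ⟨T, q₀, _, _, ⟨i⟩⟩ := hG
  obtain ⟨L, _, _, h1, h2, q, hq⟩ := exists_galois_point q₀
  let Φ := pointsEquivOfIso (Λ := specOver k L) i hq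
  exact ⟨L, _, _, h1, h2,
    (MulEquiv.ofBijective _ (constantGroupPoints_bijective k L M)).trans
      (Φ (specOver k L) (𝟙 _)).symm,
    (isSplit_constantGroup k L M).of_mulEquiv Φ (pointsEquivOfIso_naturality i hq)⟩

end Main

theorem theorem3p1 (k : Type u) [Field k] (N : Type u) [Group N] [Finite N]
    (hindec : IsIndecomposableGroup N) (hcenter : Subgroup.center N = ⊥)
    (t : ℕ) (ht : 0 < t)
    (G : Grp (Over (Spec (.of k)))) (hG : IsForm G (constantGroup k (Fin t → N))) :
    ∃ (A : Type u) (_ : CommRing A) (_ : Algebra k A),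
      Algebra.Etale k A ∧ Module.finrank k A = t ∧
      ∃ N' : Grp (Over (Spec (.of A))),
        IsForm N' (groupBaseChange (Spec.map (CommRingCat.ofHom (algebraMap k A)))
          (constantGroup k N)) ∧
        IsWeilRestriction (Spec.map (CommRingCat.ofHom (algebraMap k A))) N' G := by
  obtain ⟨L, _, _, _, _, x, hx⟩ := exists_isSplit_of_isForm hG
  obtain ⟨s, N', h1, h2⟩ := exists_weilRestriction_of_isSplit hindec hcenter x hx
  refine ⟨equivariantSubalgebra s, inferInstance, inferInstance, equivariantSubalgebra.etale s,
    ?_, N', h1, h2⟩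
  rw [equivariantSubalgebra.finrank, Fintype.card_fin]
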